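/- **3D ReLU networks.** A 3D ReLU network $\mathbb{R}^d\to\mathbb{R}$ has $K\ge 0$ hidden layers. The $k$-th hidden layer consists of $H_k\ge1$ floors, its $h$-th floor of $w_{k,h}\ge1$ neurons. The output of a neuron at floor $h$ of layer $k$ is $\sigma(\cdot)=\max\{\cdot,0\}$ applied to an affine function of all outputs of layer $k-1$ (for $k=1$: of the input) plus a linear combination of the outputs of the neurons at the floors $h'<h$ of the same layer $k$. The network's output is an affine function of the outputs of the last hidden layer (of the input, if $K=0$). For $K\ge1$ the width is $\max_{k,h}w_{k,h}$ and the height is $\max_k H_k$. $\mathcal N_{W,K,H}$ is the set of 3D ReLU networks with $K$ hidden layers, width $W$ and height $H$ (for $K=0$: of all affine maps). **Regions.** Let $d\ge 1$, $\rho>2^{\sqrt d}$, $h=(\rho-\rho^{-1})/2$, and let $E_{d,\rho}\subset\mathbb{C}^d$ be either of the two regions $$\Big\{z\in\mathbb{C}^d: \Big|\sum_{i=1}^d z_i^2\Big|+\Big|\sum_{i=1}^d z_i^2-d\Big|\le d+2h^2\Big\},\qquad \big\{z\in\mathbb{C}^d:\ |z|+\big||z|-d\big|\le d+2h^2\big\},$$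 where $|z|=(\sum_i|z_i|^2)^{1/2}$. A function $f:[0,1]^d\to\mathbb{R}$ can be analytically continued to $E_{d,\rho}$ if there is a function $F$ that is complex analytic at every point of $E_{d,\rho}$ and equals $f$ on $[0,1]^d$. **Theorem.** Let $f:[0,1]^d\to\mathbb{R}$ be bounded and such that it can be analytically continued to $E_{d,\rho}$. Then there is a constant $C>0$ such that for every integer $N\ge1$, with $$W=\left\lceil d+1+6\left(\frac{e(N+d)}{d}\right)^{d}\right\rceil,$$ $$H=\left\lceil\frac12\left(d\log_2\left((N+1)\frac{e(N+d)}{d}\right)+\log_2(6N)+\frac{N}{\sqrt d}\log_2\rho-2\right)\right\rceil,$$ there is a 3D ReLU network in $\mathcal N_{W,N-1,H}$ whose function $\Phi$ satisfies $$\sup_{x\in[0,1]^d}|f(x)-\Phi(x)|\le C\rho^{-N/\sqrt d}.$$ Moreover, for every $M$ the constant $C$ can be chosen to depend only on $d$, $\rho$ and $M$ for all those $f$ that have an analytic continuation $F$ to $E_{d,\rho}$ with $|F|\le M$ on $E_{d,\rho}$. -/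

import Mathlib

open Finset

noncomputable section

/-- A 3D ReLU network `ℝ^d → ℝ`.  Hidden layers are numbered `1, …, depth`; layer `0` is the input
layer, seen as a single floor with `d` entries.  Floors of a layer and neurons of a floor are
numbered from `0`.  Entries of the data outside the ranges `floors`, `size` play no role. -/
structure Net3D (d : ℕ) where
  /-- the number of hidden layers -/
  depth : ℕ
  /-- `floors k` is the number of floors of layer `k` -/
  floors : ℕ → ℕ
  /-- `size k h` is the number of neurons at floor `h` of layer `k` -/
  size : ℕ → ℕ → ℕ
  /-- `weight k h n h' n'`: coefficient with which the output of neuron `(h', n')` of layer `k`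
  enters neuron `(h, n)` of layer `k + 1` -/
  weight : ℕ → ℕ → ℕ → ℕ → ℕ → ℝ
  /-- `bias k h n`: bias of neuron `(h, n)` of layer `k` -/
  bias : ℕ → ℕ → ℕ → ℝ
  /-- `link k h' n' h n`: coefficient with which, inside layer `k`, the output of neuron `(h', n')`
  enters neuron `(h, n)`; it is used only for `h' < h` -/
  link : ℕ → ℕ → ℕ → ℕ → ℕ → ℝ
  /-- coefficients of the affine output layer -/
  outWeight : ℕ → ℕ → ℝ
  /-- constant term of the affine output layer -/
  outBias : ℝ
  floors_zero : floors 0 = 1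
  size_zero : size 0 0 = d
  floors_pos : ∀ k, 1 ≤ k → k ≤ depth → 0 < floors k
  size_pos : ∀ k, 1 ≤ k → k ≤ depth → ∀ h < floors k, 0 < size k h

namespace Net3D

variable {d : ℕ}

/-- `Φ.value x k h n`: the output of neuron `(h, n)` of layer `k` on the input `x`. -/
def value (Φ : Net3D d) (x : Fin d → ℝ) : ℕ → ℕ → ℕ → ℝ
  | 0, _, n => if hn : n < d then x ⟨n, hn⟩ else 0
  | k + 1, h, n =>
      max 0
        ((∑ h' ∈ range (Φ.floors k), ∑ n' ∈ range (Φ.size k h'),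
            Φ.weight k h n h' n' * Φ.value x k h' n')
          + Φ.bias (k + 1) h n
          + ∑ h' : Fin h, ∑ n' ∈ range (Φ.size (k + 1) h'),
              Φ.link (k + 1) h' n' h n * Φ.value x (k + 1) h' n')
termination_by k h _ => (k, h)

/-- The function `ℝ^d → ℝ` computed by the network. -/
def eval (Φ : Net3D d) (x : Fin d → ℝ) : ℝ :=
  (∑ h ∈ range (Φ.floors Φ.depth), ∑ n ∈ range (Φ.size Φ.depth h),
    Φ.outWeight h n * Φ.value x Φ.depth h n) + Φ.outBias

/-- The largest number of neurons at a floor of a hidden layer. -/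
def width (Φ : Net3D d) : ℕ :=
  (Finset.Icc 1 Φ.depth).sup fun k => (range (Φ.floors k)).sup fun h => Φ.size k h

/-- The largest number of floors of a hidden layer. -/
def height (Φ : Net3D d) : ℕ :=
  (Finset.Icc 1 Φ.depth).sup Φ.floors

end Net3D

/-- The class `𝒩_{W,K,H}` of 3D ReLU networks `ℝ^d → ℝ` with `K` hidden layers, width `W` and
height `H`.  For `K = 0` there are no hidden layers whose width and height could be measured, and
the class consists of the affine maps. -/
def netClass (d W K H : ℕ) : Set (Net3D d) :=
  {Φ | Φ.depth = K ∧ (K ≠ 0 → Φ.width = W ∧ Φ.height = H)}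

/-- `⌈d + 1 + 6 (e (N + d) / d) ^ d⌉` -/
def netWidth (d N : ℕ) : ℕ :=
  ⌈(d : ℝ) + 1 + 6 * (Real.exp 1 * ((N : ℝ) + d) / d) ^ d⌉₊

/-- `⌈(d log₂ ((N + 1) (e (N + d) / d)) + log₂ (6 N) + (N / √d) log₂ ρ - 2) / 2⌉` -/
def netHeight (d : ℕ) (ρ : ℝ) (N : ℕ) : ℕ :=
  ⌈1 / 2 * ((d : ℝ) * Real.logb 2 (((N : ℝ) + 1) * (Real.exp 1 * ((N : ℝ) + d) / d))
      + Real.logb 2 (6 * (N : ℝ)) + (N : ℝ) / √(d : ℝ) * Real.logb 2 ρ - 2)⌉₊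

/-- The set of `z ∈ ℂ^d` for which `w = z₁² + ⋯ + z_d²` lies in the closed elliptic region
`|w| + |w - d| ≤ d + 2 h²`, `h = (ρ - ρ⁻¹) / 2`, of the complex plane. -/
def complexEllipse (d : ℕ) (ρ : ℝ) : Set (Fin d → ℂ) :=
  {z | ‖∑ i, z i ^ 2‖ + ‖∑ i, z i ^ 2 - (d : ℂ)‖ ≤ (d : ℝ) + 2 * ((ρ - ρ⁻¹) / 2) ^ 2}

/-- The Euclidean norm on `ℂ^d`. -/
def complexNorm {d : ℕ} (z : Fin d → ℂ) : ℝ := √(∑ i, ‖z i‖ ^ 2)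

/-- The set of `z ∈ ℂ^d` with `|z| + ||z| - d| ≤ d + 2 h²`, `h = (ρ - ρ⁻¹) / 2`, where `|z|` is the
Euclidean norm. -/
def normEllipse (d : ℕ) (ρ : ℝ) : Set (Fin d → ℂ) :=
  {z | complexNorm z + |complexNorm z - (d : ℝ)| ≤ (d : ℝ) + 2 * ((ρ - ρ⁻¹) / 2) ^ 2}

/-- `F` is analytic at every point of `E` and extends the restriction of `f` to `[0,1]^d`. -/
def IsAnalyticContinuation {d : ℕ} (f : (Fin d → ℝ) → ℝ) (F : (Fin d → ℂ) → ℂ)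
    (E : Set (Fin d → ℂ)) : Prop :=
  AnalyticOnNhd ℂ F E ∧
    ∀ x ∈ Set.Icc (0 : Fin d → ℝ) 1, F (fun i => (x i : ℂ)) = (f x : ℂ)

/-- With the constant `C`, the function `f` is approximated on `[0,1]^d` at the rate
`C ρ^(-N/√d)`, for every `N ≥ 1`, by a network with `N - 1` hidden layers, width `netWidth d N` and
height `netHeight d ρ N`. -/
def ApproxByNets (d : ℕ) (ρ : ℝ) (f : (Fin d → ℝ) → ℝ) (C : ℝ) : Prop :=
  ∀ N : ℕ, 1 ≤ N → ∃ Φ ∈ netClass d (netWidth d N) (N - 1) (netHeight d ρ N),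
    ∀ x ∈ Set.Icc (0 : Fin d → ℝ) 1, |f x - Φ.eval x| ≤ C * ρ ^ (-(N : ℝ) / √(d : ℝ))

end

/-!
Put `β = ρ ^ (1 / √d) > 2`.  Both regions contain a product `polyEllipse d q` of `d` equal Bernstein
ellipses with foci `±1` and some parameter `q ≥ β`, because `d sinh² t ≤ sinh² (√d t)`; for `d ≥ 2` the
inequality is strict and one may take `q > β` (`exists_ellipse_parameter`).  Only the values of the
continuation `F` on this compact set are used, so the qualitative statement follows from the uniform
one with `M` the maximum of `|F|` there, even where the region itself is unbounded.

*Polynomial approximation.*  In one variable, `F x` is the integral of `F ((w + w⁻¹) / 2)` over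
`|w| = q` against a kernel whose expansion in `w⁻¹` has Chebyshev polynomials in `x` as coefficients
(`circleIntegral_mul_chebKernel`, `hasSum_chebKernel`); by Fubini the product kernel does the same on
the torus.  Truncation of the kernel at total degree `n` gives a polynomial
`∑ A k ∏ T (k i) (x i)` with `|A k| ≤ 2 ^ d M q ^ (-|k|)`, and the error is the tail
`∑_{|k| > n} q ^ (-|k|)`.  This is `O(β ^ (-n))` without logarithmic loss: for `d ≥ 2` since `q > β`,
and for `d = 1` since it is a geometric series (`exists_tail_le`).

*Bounded coefficients.*  On `[0, 1]` the variable `y = 2 x - 1` lies in `[-1, 1]`, and written in `y`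
the absolute coefficients of `T k` add up to at most `2 ^ k` (`sum_abs_coeff_chebCentred_le`).  As
`q > 2`, the coefficients of the approximating polynomial in the monomials of `y` are absolutely
summable, uniformly in `n`.  This is where `ρ > 2 ^ √d` enters.

*The network.*  A hidden layer multiplies every monomial of degree at most `n` by one variable: the
product `u y` is `((u + y) / 2) ^ 2 - ((u - y) / 2) ^ 2`, and each square is replaced by its sawtooth
interpolant, of which every floor contributes one term.  With `H` floors the error of a product is at
most `4 ^ (-H)`, and approximate products stay in `[-1, 1]` (`approx_mul`), so errors add up along the
layers without amplification and `n` layers compute all monomials of degree at most `n` within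
`n 4 ^ (-H)` (`exists_net_approx_polynomial`).  A floor needs four neurons for each monomial and `d`
neurons for the input, which fits into the prescribed width by `card_multiIdx_le`; the prescribed
height makes `N 4 ^ (-H) ≤ β ^ (-N)`.  The degree `n = N - 1` costs only a factor `β` in the constant.
-/

noncomputable section

/-! ### Networks with layers of equal shape -/

namespace Net3D

section Typed

variable {d : ℕ} {ι : Type*} [Fintype ι]

/-- The outputs of the neurons of one layer, floor by floor, when the neurons of every floor are
indexed by `ι`: the lowest floor receives the affine input `a`, and each further floor receives
`l` applied to the floor immediately below, plus `c`. -/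
def floorVal (l : ι → ι → ℝ) (c a : ι → ℝ) : ℕ → ι → ℝ
  | 0 => fun i => max 0 (a i)
  | h + 1 => fun i => max 0 (∑ i', l i i' * floorVal l c a h i' + c i)

/-- The outputs of hidden layer `k + 1`, when all hidden layers have `H` floors indexed by `ι` and
the same weights: `w₀` reads the input, `w` the preceding hidden layer. -/
def layerVal (H : ℕ) (w₀ : ι → Fin d → ℝ) (w : ι → ℕ → ι → ℝ) (b : ι → ℝ) (l : ι → ι → ℝ)
    (c : ι → ℝ) (x : Fin d → ℝ) : ℕ → ℕ → ι → ℝ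
  | 0 => floorVal l c fun i => ∑ j, w₀ i j * x j + b i
  | k + 1 => floorVal l c fun i =>
      (∑ h' ∈ range H, ∑ i', w i h' i' * layerVal H w₀ w b l c x k h' i') + b i

theorem value_zero (Φ : Net3D d) (x : Fin d → ℝ) (h : ℕ) (j : Fin d) :
    Φ.value x 0 h j = x j := by
  simp [value]

/-- Typed data of a network with equal layers are realised by an element of `netClass`. -/
theorem exists_net_of_layerVal (hd : 1 ≤ d) {W H : ℕ} (K : ℕ) (hH : 1 ≤ H) (hW : 1 ≤ W)
    (hι : Fintype.card ι = W)
    (w₀ : ι → Fin d → ℝ) (w : ι → ℕ → ι → ℝ) (b : ι → ℝ) (l : ι → ι → ℝ) (c : ι → ℝ)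
    (out : ℕ → ι → ℝ) (ob : ℝ) :
    ∃ Φ ∈ netClass d W K H, ∀ x, Φ.eval x =
      (match K with
        | 0 => 0
        | k + 1 => ∑ h ∈ range H, ∑ i, out h i * layerVal H w₀ w b l c x k h i) + ob := by
  classical
  let e : ι ≃ Fin W := Fintype.equivFinOfCardEq hι
  -- Neuron numbers are decoded to elements of `ι`; the value outside the range is never read.
  let dec : ℕ → ι := fun n => e.symm (if h : n < W then ⟨n, h⟩ else ⟨0, hW⟩)
  let jd : ℕ → Fin d := fun n => if h : n < d then ⟨n, h⟩ else ⟨0, hd⟩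
  have hdec : ∀ f : ι → ℝ, ∑ n ∈ range W, f (dec n) = ∑ i, f i := by
    intro f
    rw [Finset.sum_range, ← Equiv.sum_comp e.symm]
    refine Finset.sum_congr rfl fun i _ => ?_
    simp [dec]
  have hjd : ∀ j : Fin d, jd j = j := fun j => by simp [jd]
  obtain ⟨Φ, hdepth, hfl0, hfl, hsz0, hsz, hw0, hw1, hw2, hb0, hb1, hl0, hl1, ho, hob⟩ :
      ∃ Φ : Net3D d, Φ.depth = K ∧ Φ.floors 0 = 1 ∧ (∀ k, Φ.floors (k + 1) = H) ∧
        (∀ h, Φ.size 0 h = d) ∧ (∀ k h, Φ.size (k + 1) h = W) ∧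
        (∀ n h' n', Φ.weight 0 0 n h' n' = w₀ (dec n) (jd n')) ∧
        (∀ k n h' n', Φ.weight (k + 1) 0 n h' n' = w (dec n) h' (dec n')) ∧
        (∀ k h n h' n', Φ.weight k (h + 1) n h' n' = 0) ∧
        (∀ k n, Φ.bias k 0 n = b (dec n)) ∧ (∀ k h n, Φ.bias k (h + 1) n = c (dec n)) ∧
        (∀ k h n n', Φ.link k h n' (h + 1) n = l (dec n) (dec n')) ∧
        (∀ k h h' n n', h' < h → Φ.link k h' n' (h + 1) n = 0) ∧
        (∀ h n, Φ.outWeight h n = if K = 0 then 0 else out h (dec n)) ∧ Φ.outBias = ob :=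
    ⟨{ depth := K
       floors := fun k => if k = 0 then 1 else H
       size := fun k _ => if k = 0 then d else W
       weight := fun k h n h' n' =>
         if h = 0 then (if k = 0 then w₀ (dec n) (jd n') else w (dec n) h' (dec n')) else 0
       bias := fun _ h n => if h = 0 then b (dec n) else c (dec n)
       link := fun _ h' n' h n => if h' + 1 = h then l (dec n) (dec n') else 0
       outWeight := fun h n => if K = 0 then 0 else out h (dec n)
       outBias := ob
       floors_zero := by simp
       size_zero := by simp
       floors_pos := by
         intro k hk _
         rw [if_neg (by omega)]
         omega
       size_pos := by
         intro k hk _ h _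
         rw [if_neg (by omega)]
         omega },
      rfl, rfl, fun _ => rfl, fun _ => rfl, fun _ _ => rfl, fun _ _ _ => rfl, fun _ _ _ _ => rfl,
      fun _ _ _ _ _ => rfl, fun _ _ => rfl, fun _ _ _ => rfl, fun _ _ _ _ => if_pos rfl,
      fun _ _ _ _ _ hh => if_neg (by omega), fun _ _ => rfl, rfl⟩
  have hval : ∀ x k h n, Φ.value x (k + 1) h n = layerVal H w₀ w b l c x k h (dec n) := by
    intro x
    have step : ∀ k h, (∀ n, Φ.value x (k + 1) h n = layerVal H w₀ w b l c x k h (dec n)) →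
        ∀ n, Φ.value x (k + 1) (h + 1) n =
          max 0 (∑ i, l (dec n) i * layerVal H w₀ w b l c x k h i + c (dec n)) := by
      intro k h ih n
      rw [value]
      congr 1
      rw [Fin.sum_univ_castSucc, Finset.sum_eq_zero (s := (univ : Finset (Fin h)))]
      · simp only [Fin.val_last, hsz, ih, hw2, hl0, hb1, zero_mul, sum_const_zero, zero_add]
        rw [hdec fun i => l (dec n) i * layerVal H w₀ w b l c x k h i]
        ring
      · intro i _
        refine Finset.sum_eq_zero fun n' _ => ?_
        rw [Fin.val_castSucc, hl1 _ _ _ _ _ i.2, zero_mul]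
    intro k
    induction k with
    | zero =>
      intro h
      induction h with
      | zero =>
        intro n
        rw [value]
        simp only [layerVal, floorVal]
        congr 1
        rw [hfl0, Finset.sum_range_one, hsz0, Finset.sum_range]
        simp only [hw0, hjd, value_zero, hb0, univ_eq_empty, sum_empty, add_zero]
      | succ h ih => exact step _ h ih
    | succ k ihk =>
      intro h
      induction h with
      | zero =>
        intro n
        rw [value]
        simp only [layerVal, floorVal]
        congr 1
        simp only [hfl, hsz, ihk, hw1, hb0, univ_eq_empty, sum_empty, add_zero]
        congr 1
        exact Finset.sum_congr rfl fun h' _ =>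
          hdec fun i => w (dec n) h' i * layerVal H w₀ w b l c x k h' i
      | succ h ih => exact step _ h ih
  refine ⟨Φ, ⟨hdepth, fun hK => ⟨?_, ?_⟩⟩, fun x => ?_⟩
  · obtain ⟨k, rfl⟩ := Nat.exists_eq_succ_of_ne_zero hK
    apply le_antisymm
    · refine Finset.sup_le fun k hk => Finset.sup_le fun h _ => ?_
      obtain ⟨k, rfl⟩ := Nat.exists_eq_succ_of_ne_zero
        (Nat.one_le_iff_ne_zero.1 (Finset.mem_Icc.1 hk).1)
      exact (hsz _ _).le
    · refine le_trans ?_ (Finset.le_sup (b := 1) (by simp [hdepth]))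
      refine le_trans ?_ (Finset.le_sup (b := 0) (by rw [hfl 0]; simp; omega))
      rw [hsz 0]
  · obtain ⟨k, rfl⟩ := Nat.exists_eq_succ_of_ne_zero hK
    apply le_antisymm
    · refine Finset.sup_le fun k hk => ?_
      obtain ⟨k, rfl⟩ := Nat.exists_eq_succ_of_ne_zero
        (Nat.one_le_iff_ne_zero.1 (Finset.mem_Icc.1 hk).1)
      exact (hfl _).le
    · refine le_trans ?_ (Finset.le_sup (b := 1) (by simp [hdepth]))
      rw [hfl 0]
  · rw [eval, hdepth, hob]
    cases K with
    | zero => simp [ho]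
    | succ k =>
      simp only [hfl, hsz, hval, ho, Nat.add_one_ne_zero, if_false]
      congr 1
      exact Finset.sum_congr rfl fun h _ => hdec fun i => out h i * layerVal H w₀ w b l c x k h i

end Typed

end Net3D

/-! ### Approximate multiplication by sawtooth functions -/

/-- The tent map of `[0, 1]`, as a combination of two ReLU functions. -/
def tent (t : ℝ) : ℝ := 2 * max 0 t - 4 * max 0 (t - 1 / 2)

theorem tent_mem {t : ℝ} (ht : t ∈ Set.Icc (0 : ℝ) 1) : tent t ∈ Set.Icc (0 : ℝ) 1 := by
  obtain ⟨h0, h1⟩ := ht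
  rw [tent, max_eq_right h0]
  rcases le_total t (1 / 2) with h | h
  · rw [max_eq_left (by linarith)]; constructor <;> linarith
  · rw [max_eq_right (by linarith)]; constructor <;> linarith

theorem mul_one_sub_eq_tent {t : ℝ} (ht : t ∈ Set.Icc (0 : ℝ) 1) :
    4 * (t * (1 - t)) = tent t + tent t * (1 - tent t) := by
  obtain ⟨h0, h1⟩ := ht
  rw [tent, max_eq_right h0]
  rcases le_total t (1 / 2) with h | h
  · rw [max_eq_left (by linarith)]; ring
  · rw [max_eq_right (by linarith)]; ring

theorem tent_iterate_mem {t : ℝ} (ht : t ∈ Set.Icc (0 : ℝ) 1) (h : ℕ) :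
    tent^[h] t ∈ Set.Icc (0 : ℝ) 1 := by
  induction h with
  | zero => exact ht
  | succ h ih => rw [Function.iterate_succ_apply']; exact tent_mem ih

/-- With `z = 2 t - 1`, the function `1 - sawSum H t` is the piecewise linear interpolant of `z ^ 2`
on the dyadic grid of mesh `2 ^ (1 - H)`. -/
def sawSum (H : ℕ) (t : ℝ) : ℝ := ∑ h ∈ range H, (1 / 4 : ℝ) ^ h * tent^[h + 1] t

theorem sawSum_eq {t : ℝ} (ht : t ∈ Set.Icc (0 : ℝ) 1) (H : ℕ) :
    4 * (t * (1 - t)) = sawSum H t + 4 * (1 / 4) ^ H * (tent^[H] t * (1 - tent^[H] t)) := by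
  induction H with
  | zero => simp [sawSum]
  | succ H ih =>
    rw [sawSum, Finset.sum_range_succ, ← sawSum, ih]
    have := mul_one_sub_eq_tent (tent_iterate_mem ht H)
    rw [Function.iterate_succ_apply', pow_succ]
    linear_combination (1 / 4 : ℝ) ^ H * this

theorem sawSum_bounds {t : ℝ} (ht : t ∈ Set.Icc (0 : ℝ) 1) (H : ℕ) :
    0 ≤ sawSum H t ∧ sawSum H t ≤ 4 * (t * (1 - t)) ∧
      4 * (t * (1 - t)) ≤ sawSum H t + (1 / 4) ^ H := by
  obtain ⟨h0, h1⟩ := tent_iterate_mem ht H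
  have hp : (0 : ℝ) < (1 / 4) ^ H := by positivity
  have e := sawSum_eq ht H
  have a : 0 ≤ tent^[H] t * (1 - tent^[H] t) := mul_nonneg h0 (by linarith)
  have b : tent^[H] t * (1 - tent^[H] t) ≤ 1 / 4 := by nlinarith [sq_nonneg (tent^[H] t - 1 / 2)]
  refine ⟨Finset.sum_nonneg fun h _ => ?_, ?_, ?_⟩
  · exact mul_nonneg (by positivity) (tent_iterate_mem ht _).1
  · nlinarith
  · nlinarith

/-- The product `u * y` of two numbers of `[-1, 1]`, as a difference of two squares, each replaced
by its sawtooth interpolant.  The interpolants take values in `[0, 1]`, so the approximate product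
stays in `[-1, 1]` and can be used as a factor again. -/
theorem approx_mul {u y : ℝ} (hu : |u| ≤ 1) (hy : |y| ≤ 1) (H : ℕ) :
    |sawSum H (1 / 2 + (u - y) / 4) - sawSum H (1 / 2 + (u + y) / 4)| ≤ 1 ∧
    |sawSum H (1 / 2 + (u - y) / 4) - sawSum H (1 / 2 + (u + y) / 4) - u * y| ≤ (1 / 4) ^ H := by
  rw [abs_le] at hu hy
  obtain ⟨a0, a1, a2⟩ := sawSum_bounds (t := 1 / 2 + (u - y) / 4)
    ⟨by linarith, by linarith⟩ H
  obtain ⟨b0, b1, b2⟩ := sawSum_bounds (t := 1 / 2 + (u + y) / 4)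
    ⟨by linarith, by linarith⟩ H
  have e1 := sq_nonneg ((u - y) / 4)
  have e2 := sq_nonneg ((u + y) / 4)
  constructor <;> rw [abs_le] <;> constructor <;> nlinarith

/-! ### Networks computing all monomials of bounded degree -/

namespace MonomialNet

variable {d : ℕ} {S : Type*} {r : ℕ}

/-- Neurons of a floor: for every monomial, a pair of neurons for each of the two squares, then
`d` neurons that pass on the input, then `r` idle ones.  The first Boolean selects the square (of
`(u + y) / 2` or `(u - y) / 2`), the second one the ReLU function of the tent map. -/
abbrev Idx (S : Type*) (d r : ℕ) : Type _ := (S × Bool × Bool) ⊕ (Fin d ⊕ Fin r)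

/-- The sign of `y` in the argument of a square. -/
def sgn (s : Bool) : ℝ := if s then -1 else 1

/-- Coefficients of the two ReLU functions in `tent`. -/
def tentCoef (s : Bool) : ℝ := if s then -4 else 2

/-- Shifts of the two ReLU functions in `tent`. -/
def tentShift (s : Bool) : ℝ := if s then -(1 / 2) else 0

variable [DecidableEq S] (deg : S → ℕ) (parent : S → S) (var : S → Fin d)

/-- Coefficient of neuron `i` of floor `h` in the approximate value of the monomial `m`. -/
def readout (m : S) (h : ℕ) : Idx S d r → ℝ
  | Sum.inl (m', s, s') =>
      if deg m ≠ 0 ∧ m' = m then -((1 / 4) ^ h * sgn s * tentCoef s') else 0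
  | Sum.inr _ => 0

/-- Weights between the input and the lowest floor of the first layer. -/
def inWeight : Idx S d r → Fin d → ℝ
  | Sum.inl (m, s, _), j => sgn s * (if j = var m then 1 / 2 else 0)
  | Sum.inr (Sum.inl j'), j => if j = j' then 1 else 0
  | Sum.inr (Sum.inr _), _ => 0

/-- Weights between a layer and the lowest floor of the next one. -/
def layerWeight : Idx S d r → ℕ → Idx S d r → ℝ
  | Sum.inl (m, s, _), h, i => readout deg (parent m) h i / 4 +
      sgn s * (if h = 0 ∧ i = Sum.inr (Sum.inl (var m)) then 1 / 2 else 0)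
  | Sum.inr (Sum.inl j), h, i => if h = 0 ∧ i = Sum.inr (Sum.inl j) then 1 else 0
  | Sum.inr (Sum.inr _), _, _ => 0

/-- Biases of the lowest floor. -/
def bottomBias : Idx S d r → ℝ
  | Sum.inl (m, s, s') =>
      1 / 2 + ((if deg (parent m) = 0 then 1 else 0) - sgn s) / 4 + tentShift s'
  | Sum.inr _ => 0

/-- Weights between consecutive floors of a layer. -/
def floorWeight : Idx S d r → Idx S d r → ℝ
  | Sum.inl (m, s, _), Sum.inl (m', t, t') => if m' = m ∧ t = s then tentCoef t' else 0
  | _, _ => 0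

/-- Biases of the higher floors. -/
def floorBias : Idx S d r → ℝ
  | Sum.inl (_, _, s') => tentShift s'
  | Sum.inr _ => 0

variable [Fintype S]

theorem floorVal_inl (a : Idx S d r → ℝ) (τ : S → Bool → ℝ)
    (ha : ∀ m s s', a (Sum.inl (m, s, s')) = τ m s + tentShift s') (h : ℕ) (m : S) (s s' : Bool) :
    Net3D.floorVal floorWeight floorBias a h (Sum.inl (m, s, s')) =
      max 0 (tent^[h] (τ m s) + tentShift s') := by
  induction h generalizing m s s' with
  | zero => simp [Net3D.floorVal, ha]
  | succ h ih =>
    rw [Net3D.floorVal, Function.iterate_succ_apply']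
    simp only [Fintype.sum_sum_type, Fintype.sum_prod_type, floorWeight, ih, floorBias]
    congr 2
    rw [Finset.sum_eq_single m (fun m' _ hm => by simp [hm]) (by simp)]
    cases s <;> simp [tentCoef, tentShift, tent] <;> ring_nf

/-- The network's approximate value of the monomial `m` after `k` hidden layers.  The value is
meaningful only for monomials of degree at most `k`. -/
def approx (H r : ℕ) (x : Fin d → ℝ) (k : ℕ) (m : S) : ℝ :=
  (if deg m = 0 then 1 else 0) +
    match k with
    | 0 => 0
    | k + 1 => ∑ h ∈ range H, ∑ i : Idx S d r, readout deg m h i *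
        Net3D.layerVal H (inWeight var) (layerWeight deg parent var) (bottomBias deg parent)
          floorWeight floorBias x k h i

theorem sum_readout_mul (H : ℕ) (m : S) (hm : deg m ≠ 0) (a : Idx S d r → ℝ) (τ : S → Bool → ℝ)
    (ha : ∀ m s s', a (Sum.inl (m, s, s')) = τ m s + tentShift s') :
    ∑ h ∈ range H, ∑ i : Idx S d r, readout deg m h i *
      Net3D.floorVal floorWeight floorBias a h i =
      sawSum H (τ m true) - sawSum H (τ m false) := by
  rw [sawSum, sawSum, ← Finset.sum_sub_distrib]
  refine Finset.sum_congr rfl fun h _ => ?_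
  simp only [Fintype.sum_sum_type, Fintype.sum_prod_type, readout, floorVal_inl a τ ha]
  rw [Finset.sum_eq_single m (fun m' _ hm => by simp [hm]) (by simp)]
  simp only [Function.iterate_succ_apply']
  simp [tentCoef, tentShift, tent, sgn, hm]
  ring_nf

theorem layerVal_input {H : ℕ} (hH : 1 ≤ H) {x : Fin d → ℝ} (hx : ∀ j, 0 ≤ x j) (k : ℕ)
    (j : Fin d) :
    Net3D.layerVal H (inWeight (r := r) var) (layerWeight deg parent var) (bottomBias deg parent)
      floorWeight floorBias x k 0 (Sum.inr (Sum.inl j)) = x j := by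
  induction k with
  | zero => simp [Net3D.layerVal, Net3D.floorVal, inWeight, bottomBias, hx]
  | succ k ih =>
    simp only [Net3D.layerVal, Net3D.floorVal, layerWeight, bottomBias, add_zero]
    rw [Finset.sum_eq_single 0 (fun h _ hh => by simp [hh]) (fun h => by simp at h; omega),
      Finset.sum_eq_single (Sum.inr (Sum.inl j)) (fun i _ hi => by simp [hi]) (by simp), ih]
    simp [hx]

/-- Each layer multiplies the value of the parent monomial, taken from the preceding layer, by one
variable. -/
theorem approx_succ {H : ℕ} (hH : 1 ≤ H) {x : Fin d → ℝ} (hx : ∀ j, 0 ≤ x j) (k : ℕ) (m : S)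
    (hm : deg m ≠ 0) :
    approx deg parent var H r x (k + 1) m =
      sawSum H (1 / 2 + (approx deg parent var H r x k (parent m) - (2 * x (var m) - 1)) / 4) -
      sawSum H (1 / 2 + (approx deg parent var H r x k (parent m) + (2 * x (var m) - 1)) / 4) := by
  rw [approx, if_neg hm, zero_add]
  set τ : S → Bool → ℝ := fun m s =>
    1 / 2 + (approx deg parent var H r x k (parent m) + sgn s * (2 * x (var m) - 1)) / 4 with hτ
  have key : ∀ a : Idx S d r → ℝ, (∀ m s s', a (Sum.inl (m, s, s')) = τ m s + tentShift s') →
      ∑ h ∈ range H, ∑ i : Idx S d r, readout deg m h i *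
        Net3D.floorVal floorWeight floorBias a h i = _ :=
    fun a ha => sum_readout_mul deg H m hm a τ ha
  have e1 : τ m true =
      1 / 2 + (approx deg parent var H r x k (parent m) - (2 * x (var m) - 1)) / 4 := by
    simp [hτ, sgn]; ring
  have e2 : τ m false =
      1 / 2 + (approx deg parent var H r x k (parent m) + (2 * x (var m) - 1)) / 4 := by
    simp [hτ, sgn]
  rw [← e1, ← e2]
  cases k with
  | zero =>
    refine key _ fun m s s' => ?_
    simp only [hτ, inWeight, bottomBias, approx]
    rw [Finset.sum_eq_single (var m) (fun j _ hj => by simp [hj]) (by simp)]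
    simp only [if_true]
    ring
  | succ k =>
    refine key _ fun m s s' => ?_
    simp only [hτ, layerWeight, bottomBias]
    rw [approx]
    simp only [add_mul, Finset.sum_add_distrib]
    have h1 : ∑ h ∈ range H, ∑ i : Idx S d r,
        sgn s * (if h = 0 ∧ i = Sum.inr (Sum.inl (var m)) then (1 / 2 : ℝ) else 0) *
        Net3D.layerVal H (inWeight var) (layerWeight deg parent var) (bottomBias deg parent)
          floorWeight floorBias x k h i = sgn s * (1 / 2) * x (var m) := by
      rw [Finset.sum_eq_single 0 (fun h _ hh => by simp [hh]) (fun h => by simp at h; omega),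
        Finset.sum_eq_single (Sum.inr (Sum.inl (var m))) (fun i _ hi => by simp [hi]) (by simp),
        layerVal_input deg parent var hH hx]
      simp
    rw [h1]
    simp only [div_mul_eq_mul_div, ← Finset.sum_div]
    ring

/-- A monomial of degree at most `k` is available after `k` layers.  Its approximation stays in
`[-1, 1]`, so each further multiplication adds at most `4 ^ (-H)` to the error. -/
theorem approx_error {H : ℕ} (hH : 1 ≤ H) {x : Fin d → ℝ} (hx : x ∈ Set.Icc (0 : Fin d → ℝ) 1)
    (mon : S → ℝ) (h0 : ∀ m, deg m = 0 → mon m = 1)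
    (h1 : ∀ m j, deg m = j + 1 → deg (parent m) = j ∧
      mon m = mon (parent m) * (2 * x (var m) - 1)) (k : ℕ) :
    ∀ m, deg m ≤ k → |approx deg parent var H r x k m| ≤ 1 ∧
      |approx deg parent var H r x k m - mon m| ≤ deg m * (1 / 4) ^ H := by
  have hroot : ∀ k m, deg m = 0 → approx deg parent var H r x k m = 1 := by
    intro k m hm
    cases k with
    | zero => simp [approx, hm]
    | succ k =>
      rw [approx, if_pos hm]
      simp only [add_eq_left]
      refine Finset.sum_eq_zero fun h _ => Finset.sum_eq_zero fun i _ => ?_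
      rcases i with ⟨m', s, s'⟩ | i <;> simp [readout, hm]
  induction k with
  | zero =>
    intro m hm
    have hm0 : deg m = 0 := by omega
    simp [hroot _ _ hm0, h0 m hm0, hm0]
  | succ k ih =>
    intro m hm
    rcases Nat.eq_zero_or_pos (deg m) with hm0 | hm0
    · simp [hroot _ _ hm0, h0 m hm0, hm0]
    · obtain ⟨j, hj⟩ := Nat.exists_eq_succ_of_ne_zero hm0.ne'
      obtain ⟨hp, hmon⟩ := h1 m j hj
      obtain ⟨b1, b2⟩ := ih (parent m) (by omega)
      have hy : |2 * x (var m) - 1| ≤ 1 := by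
        have l0 : 0 ≤ x (var m) := hx.1 (var m)
        have l1 : x (var m) ≤ 1 := hx.2 (var m)
        rw [abs_le]; constructor <;> linarith
      rw [approx_succ deg parent var hH hx.1 k m hm0.ne']
      obtain ⟨c1, c2⟩ := approx_mul b1 hy H
      refine ⟨c1, ?_⟩
      rw [hmon, hj, Nat.cast_succ, add_one_mul, ← hp]
      refine (abs_sub_le _ (approx deg parent var H r x k (parent m) * (2 * x (var m) - 1)) _).trans
        ((add_le_add c2 ?_).trans_eq (add_comm _ _))
      rw [← sub_mul, abs_mul]
      exact (mul_le_of_le_one_right (abs_nonneg _) hy).trans b2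

end MonomialNet

open MonomialNet in
/-- A polynomial of degree `n` in the variables `2 x j - 1` is computed by `n` hidden layers with
`H` floors, up to `n 4 ^ (-H)` times the sum of its absolute coefficients.  The monomials are indexed
by an arbitrary type in which every monomial of positive degree is a variable times another one. -/
theorem exists_net_approx_polynomial {d : ℕ} (hd : 1 ≤ d) {S : Type*} [Fintype S] {n W H : ℕ}
    (hH : 1 ≤ H) (hW : 4 * Fintype.card S + d ≤ W) (deg : S → ℕ) (hdeg : ∀ m, deg m ≤ n)
    (parent : S → S) (var : S → Fin d) (mon : (Fin d → ℝ) → S → ℝ)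
    (h0 : ∀ x m, deg m = 0 → mon x m = 1)
    (h1 : ∀ m j, deg m = j + 1 → deg (parent m) = j ∧
      ∀ x, mon x m = mon x (parent m) * (2 * x (var m) - 1)) (coef : S → ℝ) :
    ∃ Φ ∈ netClass d W n H, ∀ x ∈ Set.Icc (0 : Fin d → ℝ) 1,
      |∑ m, coef m * mon x m - Φ.eval x| ≤ (∑ m, |coef m|) * (n * (1 / 4) ^ H) := by
  classical
  obtain ⟨r, hr⟩ := Nat.exists_eq_add_of_le hW
  have hcard : Fintype.card (Idx S d r) = W := by
    simp [Idx, hr]; ring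
  obtain ⟨Φ, hΦ, hev⟩ := Net3D.exists_net_of_layerVal hd n hH (by omega) hcard (inWeight var)
    (layerWeight deg parent var) (bottomBias deg parent) floorWeight floorBias
    (fun h i => ∑ m, coef m * readout deg m h i)
    (∑ m, coef m * if deg m = 0 then 1 else 0)
  refine ⟨Φ, hΦ, fun x hx => ?_⟩
  have hev' : Φ.eval x = ∑ m, coef m * approx deg parent var H r x n m := by
    rw [hev]
    simp only [approx, mul_add, Finset.sum_add_distrib]
    rw [add_comm]
    congr 1
    cases n with
    | zero => simp
    | succ k =>
      simp only [Finset.sum_mul, Finset.mul_sum]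
      rw [Finset.sum_comm]
      conv_rhs => rw [Finset.sum_comm]
      conv_lhs => rw [Finset.sum_comm]
      refine Finset.sum_congr rfl fun h _ => ?_
      rw [Finset.sum_comm]
      exact Finset.sum_congr rfl fun m _ => Finset.sum_congr rfl fun i _ => by ring
  rw [hev', ← Finset.sum_sub_distrib, Finset.sum_mul]
  refine (Finset.abs_sum_le_sum_abs _ _).trans (Finset.sum_le_sum fun m _ => ?_)
  rw [← mul_sub, abs_mul, abs_sub_comm]
  refine mul_le_mul_of_nonneg_left ?_ (abs_nonneg _)
  refine ((approx_error deg parent var hH hx (mon x) (h0 x)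
    (fun m j hj => ⟨(h1 m j hj).1, (h1 m j hj).2 x⟩) n m (hdeg m)).2).trans ?_
  gcongr
  exact hdeg m

/-! ### Multi-indices -/

/-- The multi-indices of total degree at most `n`. -/
def multiIdx (d n : ℕ) : Finset (Fin d → ℕ) :=
  (Fintype.piFinset fun _ => range (n + 1)).filter fun k => ∑ i, k i ≤ n

theorem mem_multiIdx {d n : ℕ} {k : Fin d → ℕ} : k ∈ multiIdx d n ↔ ∑ i, k i ≤ n := by
  simp only [multiIdx, mem_filter, Fintype.mem_piFinset, mem_range, and_iff_right_iff_imp]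
  exact fun h i => Nat.lt_succ_of_le ((single_le_sum (fun _ _ => Nat.zero_le _) (mem_univ i)).trans h)

theorem sum_box_pow_le {r : ℝ} (h0 : 0 ≤ r) (h1 : r < 1) (d L : ℕ) :
    ∑ k ∈ Fintype.piFinset (fun _ : Fin d => range L), r ^ ∑ i, k i ≤ ((1 - r)⁻¹) ^ d := by
  simp only [← prod_pow_eq_pow_sum]
  rw [← prod_univ_sum (fun _ => range L) fun _ j => r ^ j, prod_const, card_univ, Fintype.card_fin]
  gcongr
  rw [← tsum_geometric_of_lt_one h0 h1]
  exact (summable_geometric_of_lt_one h0 h1).sum_le_tsum _ fun _ _ => by positivity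

/-- The number of monomials of degree at most `n` in `d` variables is at most `(e (n + d) / d) ^ d`:
weigh the monomials by powers of `n / (n + d)`. -/
theorem card_multiIdx_le {d n : ℕ} (hd : 1 ≤ d) (hn : 1 ≤ n) :
    (#(multiIdx d n) : ℝ) ≤ (Real.exp 1 * ((n : ℝ) + d) / d) ^ d := by
  have hd' : (0 : ℝ) < d := by exact_mod_cast hd
  have hn' : (0 : ℝ) < n := by exact_mod_cast hn
  set r : ℝ := n / (n + d) with hr
  have h0 : 0 < r := by positivity
  have h1 : r < 1 := by rw [hr, div_lt_one (by positivity)]; linarith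
  -- Each multi-index has weight at least `r ^ n`, and the weights of the whole box are a product.
  have key : (#(multiIdx d n) : ℝ) * r ^ n ≤ ((1 - r)⁻¹) ^ d := by
    refine le_trans ?_ (sum_box_pow_le h0.le h1 d (n + 1))
    rw [← nsmul_eq_mul, ← sum_const]
    refine (sum_le_sum fun k hk => ?_).trans
      (sum_le_sum_of_subset_of_nonneg (filter_subset _ _) fun _ _ _ => by positivity)
    exact pow_le_pow_of_le_one h0.le h1.le (mem_multiIdx.1 hk)
  have e1 : (1 - r)⁻¹ = ((n : ℝ) + d) / d := by
    have : 1 - r = d / ((n : ℝ) + d) := by rw [hr]; field_simp; ring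
    rw [this, inv_div]
  have e2 : (r⁻¹) ^ n ≤ Real.exp 1 ^ d := by
    have : r⁻¹ = (d : ℝ) / n + 1 := by rw [hr]; field_simp; ring
    rw [this]
    calc ((d : ℝ) / n + 1) ^ n ≤ (Real.exp (d / n)) ^ n := by
          gcongr; exact Real.add_one_le_exp _
      _ = Real.exp 1 ^ d := by
          rw [← Real.exp_nat_mul, ← Real.exp_nat_mul]; congr 1; field_simp
  rw [e1] at key
  rw [mul_div_assoc, mul_pow]
  calc (#(multiIdx d n) : ℝ) = #(multiIdx d n) * r ^ n * r⁻¹ ^ n := by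
        rw [mul_assoc, ← mul_pow, mul_inv_cancel₀ h0.ne', one_pow, mul_one]
    _ ≤ (((n : ℝ) + d) / d) ^ d * Real.exp 1 ^ d := by gcongr
    _ = _ := mul_comm _ _

/-- The tail bound on which the rate rests.  The alternatives are those of `d ≥ 2`, where the
ratio has room to spare and the number of multi-indices of given degree is harmless, and `d = 1`,
where there is no room and none is needed. -/
theorem exists_tail_le {d : ℕ} {β q : ℝ} (hβ : 1 < β) (h : β < q ∨ d = 1 ∧ q = β) :
    ∃ B : ℝ, 0 ≤ B ∧ ∀ n L : ℕ,
      ∑ k ∈ (Fintype.piFinset fun _ : Fin d => range L).filter (fun k => n < ∑ i, k i),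
        (q⁻¹) ^ ∑ i, k i ≤ B * (β⁻¹) ^ n := by
  rcases h with h | ⟨rfl, rfl⟩
  · have hβ0 : 0 < β := by linarith
    have hq0 : 0 < q := by linarith
    have hr0 : 0 ≤ β / q := by positivity
    have hr1 : β / q < 1 := by rw [div_lt_one (by linarith)]; exact h
    refine ⟨((1 - β / q)⁻¹) ^ d, by have := sub_pos.2 hr1; positivity, fun n L => ?_⟩
    refine le_trans ?_ (mul_le_mul_of_nonneg_right (sum_box_pow_le hr0 hr1 d L) (by positivity))
    rw [sum_mul]
    refine (sum_le_sum fun k hk => ?_).trans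
      (sum_le_sum_of_subset_of_nonneg (filter_subset _ _) fun _ _ _ => by positivity)
    have hk' := (mem_filter.1 hk).2
    have : q⁻¹ = β / q * β⁻¹ := by field_simp
    rw [this, mul_pow]
    gcongr ?_ * ?_
    exact pow_le_pow_of_le_one (by positivity) (inv_le_one_of_one_le₀ hβ.le) hk'.le
  · have hr0 : 0 ≤ q⁻¹ := by positivity
    have hr1 : q⁻¹ < 1 := inv_lt_one_of_one_lt₀ hβ
    refine ⟨(1 - q⁻¹)⁻¹, by have := sub_pos.2 hr1; positivity, fun n L => ?_⟩
    rw [← tsum_geometric_of_lt_one hr0 hr1]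
    simp only [univ_unique, Fin.default_eq_zero, sum_singleton]
    calc _ = ∑ k ∈ (Fintype.piFinset fun _ : Fin 1 => range L).filter (fun k => n < k 0),
          (q⁻¹) ^ (k 0 - n) * (q⁻¹) ^ n := by
          refine sum_congr rfl fun k hk => ?_
          rw [← pow_add, Nat.sub_add_cancel (mem_filter.1 hk).2.le]
      _ ≤ _ := by
          rw [← sum_mul]
          gcongr
          rw [← sum_image (f := fun j => (q⁻¹) ^ j) (g := fun k : Fin 1 → ℕ => k 0 - n)]
          · exact (summable_geometric_of_lt_one hr0 hr1).sum_le_tsum _ fun _ _ => by positivity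
          · intro k hk k' hk' e
            have h1 := (mem_filter.1 hk).2
            have h2 := (mem_filter.1 hk').2
            ext i
            rw [Subsingleton.elim i 0]
            simp only at e
            omega

/-! ### Chebyshev polynomials centred at `1 / 2` -/

section Chebyshev

open Polynomial

/-- The Chebyshev polynomial `T k`, as a polynomial in `y = 2 x - 1`. -/
def chebCentred (k : ℕ) : ℝ[X] := (Chebyshev.T ℝ k).comp (C (1 / 2) * (X + 1))

theorem chebCentred_eval (k : ℕ) (x : ℝ) :
    (chebCentred k).eval (2 * x - 1) = (Chebyshev.T ℝ k).eval x := by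
  rw [chebCentred, eval_comp]
  congr 1
  simp

theorem chebCentred_add_three (k : ℕ) :
    chebCentred (k + 3) =
      X * (chebCentred (k + 2) + chebCentred (k + 1)) - chebCentred k := by
  have h1 := Chebyshev.T_add_two ℝ ((k : ℤ) + 1)
  have h2 := Chebyshev.T_add_two ℝ (k : ℤ)
  have h3 : (2 : ℝ[X]) * C (1 / 2) = 1 := by
    rw [← C_ofNat, ← C_mul]; norm_num
  rw [show (k : ℤ) + 1 + 2 = ((k + 3 : ℕ) : ℤ) by push_cast; ring,
    show (k : ℤ) + 1 + 1 = ((k + 2 : ℕ) : ℤ) by push_cast; ring,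
    show (k : ℤ) + 1 = ((k + 1 : ℕ) : ℤ) by push_cast; ring] at h1
  rw [show (k : ℤ) + 2 = ((k + 2 : ℕ) : ℤ) by push_cast; ring,
    show (k : ℤ) + 1 = ((k + 1 : ℕ) : ℤ) by push_cast; ring] at h2
  simp only [chebCentred]
  generalize hg : (C (1 / 2) * (X + 1) : ℝ[X]) = g
  have hX : (X : ℝ[X]) = 2 * g - 1 := by
    rw [← hg]; linear_combination (-(X + 1)) * h3
  replace h1 := congrArg (fun p : ℝ[X] => p.comp g) h1
  replace h2 := congrArg (fun p : ℝ[X] => p.comp g) h2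
  simp only [sub_comp, mul_comp, X_comp, ofNat_comp] at h1 h2
  rw [hX, h1]
  linear_combination h2

theorem chebCentred_natDegree_le (k : ℕ) : (chebCentred k).natDegree ≤ k := by
  refine natDegree_comp_le.trans ?_
  have h1 : (Chebyshev.T ℝ (k : ℤ)).natDegree ≤ k := by simp
  have h2 : (C (1 / 2 : ℝ) * (X + 1)).natDegree ≤ 1 := by compute_degree
  calc _ ≤ k * 1 := Nat.mul_le_mul h1 h2
    _ = k := mul_one k

/-- In the variable `y = 2 x - 1` the absolute coefficients of `T k` add up to at most `2 ^ k`, by the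
recursion `chebCentred_add_three`. -/
theorem sum_abs_coeff_chebCentred_le (k L : ℕ) :
    ∑ j ∈ range L, |(chebCentred k).coeff j| ≤ 2 ^ k := by
  have hX : ∀ p : ℝ[X], ∑ j ∈ range L, |(X * p).coeff j| ≤ ∑ j ∈ range L, |p.coeff j| := by
    intro p
    cases L with
    | zero => simp
    | succ L =>
      rw [sum_range_succ']
      simp only [coeff_X_mul, mul_coeff_zero, coeff_X_zero, zero_mul, abs_zero, add_zero]
      exact sum_le_sum_of_subset_of_nonneg (range_subset_range.2 L.le_succ) fun _ _ _ => abs_nonneg _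
  induction k using Nat.strong_induction_on with
  | _ k ih =>
  match k, ih with
  | 0, _ =>
    have : chebCentred 0 = 1 := by simp [chebCentred]
    rw [this]
    calc ∑ j ∈ range L, |(1 : ℝ[X]).coeff j| = ∑ j ∈ range L, if j = 0 then (1 : ℝ) else 0 := by
          refine sum_congr rfl fun j _ => ?_
          rw [coeff_one]; split_ifs <;> simp
      _ ≤ 2 ^ 0 := by rw [sum_ite_eq']; split_ifs <;> norm_num
  | 1, _ =>
    have : chebCentred 1 = C (1 / 2) * X + C (1 / 2) := by simp [chebCentred]; ring
    rw [this]
    have : ∀ j, (C (1 / 2 : ℝ) * X + C (1 / 2)).coeff j =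
        (if j = 1 then 1 / 2 else 0) + if j = 0 then 1 / 2 else 0 := by
      intro j
      simp only [coeff_add, coeff_C_mul_X, coeff_C]
    calc ∑ j ∈ range L, |(C (1 / 2 : ℝ) * X + C (1 / 2)).coeff j| =
        ∑ j ∈ range L, ((if j = 1 then (1 / 2 : ℝ) else 0) + if j = 0 then 1 / 2 else 0) := by
          refine sum_congr rfl fun j _ => ?_
          rw [this, abs_of_nonneg]
          split_ifs <;> norm_num
      _ ≤ 2 ^ 1 := by
          rw [sum_add_distrib, sum_ite_eq', sum_ite_eq']; split_ifs <;> norm_num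
  | 2, _ =>
    have : chebCentred 2 = C (1 / 2) * X ^ 2 + C 1 * X + C (-(1 / 2)) := by
      have h3 : (2 : ℝ[X]) * C (1 / 2) = 1 := by
        rw [← C_ofNat, ← C_mul]; norm_num
      simp only [chebCentred, Nat.cast_ofNat, Chebyshev.T_two, sub_comp, mul_comp, ofNat_comp,
        pow_comp, X_comp, one_comp, C_1, C_neg]
      linear_combination (C (1 / 2) * (X + 1) ^ 2 + X + 1) * h3
    rw [this]
    have : ∀ j, (C (1 / 2 : ℝ) * X ^ 2 + C 1 * X + C (-(1 / 2))).coeff j =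
        (if j = 2 then 1 / 2 else 0) + (if j = 1 then 1 else 0) +
          if j = 0 then -(1 / 2) else 0 := by
      intro j
      simp only [coeff_add, coeff_C_mul_X, coeff_C, coeff_C_mul_X_pow]
    calc ∑ j ∈ range L, |(C (1 / 2 : ℝ) * X ^ 2 + C 1 * X + C (-(1 / 2))).coeff j| ≤
        ∑ j ∈ range L, ((if j = 2 then (1 / 2 : ℝ) else 0) + (if j = 1 then 1 else 0) +
          if j = 0 then 1 / 2 else 0) := by
          refine sum_le_sum fun j _ => ?_
          rw [this]
          split_ifs <;> norm_num [abs_le]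
      _ ≤ 2 ^ 2 := by
          rw [sum_add_distrib, sum_add_distrib, sum_ite_eq', sum_ite_eq', sum_ite_eq']
          split_ifs <;> norm_num
  | k + 3, ih =>
    rw [chebCentred_add_three]
    calc _ ≤ ∑ j ∈ range L, (|(X * chebCentred (k + 2)).coeff j| +
          |(X * chebCentred (k + 1)).coeff j| + |(chebCentred k).coeff j|) := by
          refine sum_le_sum fun j _ => ?_
          rw [mul_add, coeff_sub, coeff_add]
          exact (abs_sub _ _).trans (add_le_add_left (abs_add_le _ _) _)
      _ ≤ 2 ^ (k + 2) + 2 ^ (k + 1) + 2 ^ k := by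
          rw [sum_add_distrib, sum_add_distrib]
          exact add_le_add (add_le_add ((hX _).trans (ih _ (by omega)))
            ((hX _).trans (ih _ (by omega)))) (ih _ (by omega))
      _ ≤ 2 ^ (k + 3) := by
          have : (0 : ℝ) < 2 ^ k := by positivity
          rw [pow_add, pow_add, pow_add]; linarith

/-- Coefficient of `∏ i, y i ^ m i` in `∏ i, T (k i) (x i)`, where `y = 2 x - 1`. -/
def prodCoeff {d : ℕ} (k m : Fin d → ℕ) : ℝ := ∏ i, (chebCentred (k i)).coeff (m i)

theorem prod_cheb_eq_sum {d n : ℕ} {k : Fin d → ℕ} (hk : k ∈ multiIdx d n) (x : Fin d → ℝ) :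
    ∏ i, (Chebyshev.T ℝ (k i)).eval (x i) =
      ∑ m ∈ multiIdx d n, prodCoeff k m * ∏ i, (2 * x i - 1) ^ m i := by
  have hk' := mem_multiIdx.1 hk
  have h1 : ∀ i, (Chebyshev.T ℝ (k i)).eval (x i) =
      ∑ j ∈ range (n + 1), (chebCentred (k i)).coeff j * (2 * x i - 1) ^ j := by
    intro i
    rw [← chebCentred_eval, eval_eq_sum_range' (Nat.lt_succ_of_le
      ((chebCentred_natDegree_le _).trans
        ((single_le_sum (fun _ _ => Nat.zero_le _) (mem_univ i)).trans hk')))]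
  simp only [h1]
  rw [prod_univ_sum, multiIdx, sum_filter_of_ne]
  · exact sum_congr rfl fun m _ => prod_mul_distrib
  · intro m _ hm
    refine le_trans (sum_le_sum fun i _ => ?_) hk'
    by_contra hlt
    refine hm ?_
    have : prodCoeff k m = 0 := prod_eq_zero (mem_univ i)
      (coeff_eq_zero_of_natDegree_lt ((chebCentred_natDegree_le _).trans_lt (not_le.1 hlt)))
    rw [this, zero_mul]

theorem sum_abs_prodCoeff_le {d : ℕ} (n : ℕ) (k : Fin d → ℕ) :
    ∑ m ∈ multiIdx d n, |prodCoeff k m| ≤ 2 ^ ∑ i, k i := by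
  calc _ ≤ ∑ m ∈ Fintype.piFinset (fun _ : Fin d => range (n + 1)), |prodCoeff k m| :=
        sum_le_sum_of_subset_of_nonneg (filter_subset _ _) fun _ _ _ => abs_nonneg _
    _ = ∏ i, ∑ j ∈ range (n + 1), |(chebCentred (k i)).coeff j| := by
        rw [prod_univ_sum]
        exact sum_congr rfl fun m _ => abs_prod _ _
    _ ≤ ∏ i, 2 ^ k i := prod_le_prod (fun i _ => sum_nonneg fun _ _ => abs_nonneg _)
        fun i _ => sum_abs_coeff_chebCentred_le _ _
    _ = _ := prod_pow_eq_pow_sum _ _ _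

end Chebyshev

/-! ### The Chebyshev kernel on circles -/

section Kernel

open Complex Metric

/-- The map `w ↦ (w + w⁻¹) / 2`, which sends the circles `|w| = r` onto confocal ellipses. -/
def joukowski (w : ℂ) : ℂ := (w + w⁻¹) / 2

/-- The closed Bernstein ellipse with foci `±1` and parameter `q`. -/
def bernsteinEllipse (q : ℝ) : Set ℂ := joukowski '' {w | 1 ≤ ‖w‖ ∧ ‖w‖ ≤ q}

/-- The kernel that reproduces `φ x` from the values of `φ ∘ joukowski` on a circle about `0`; it is
the generating function of the Chebyshev polynomials in `w⁻¹`, times `w⁻¹`. -/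
def chebKernel (x : ℝ) (w : ℂ) : ℂ := (w ^ 2 - 1) / (w * (w ^ 2 - 2 * x * w + 1))

theorem exists_unit_of_abs_le_one {x : ℝ} (hx : |x| ≤ 1) :
    ∃ v : ℂ, ‖v‖ = 1 ∧ v ≠ 0 ∧ v + v⁻¹ = 2 * x ∧
      ∀ k : ℕ, (((Polynomial.Chebyshev.T ℝ k).eval x : ℝ) : ℂ) = (v ^ k + v⁻¹ ^ k) / 2 := by
  rw [abs_le] at hx
  refine ⟨exp (Real.arccos x * I), norm_exp_ofReal_mul_I _, exp_ne_zero _, ?_, fun k => ?_⟩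
  · rw [← exp_neg, ← neg_mul, ← two_cos, ← ofReal_cos, Real.cos_arccos hx.1 hx.2]
  · conv_lhs => rw [← Real.cos_arccos hx.1 hx.2]
    rw [Polynomial.Chebyshev.T_real_cos, ofReal_cos, cos, ← exp_neg, ← exp_nat_mul, ← exp_nat_mul]
    push_cast
    ring_nf

theorem chebKernel_denom_eq {x : ℝ} {v : ℂ} (hv0 : v ≠ 0) (hv : v + v⁻¹ = 2 * x) (w : ℂ) :
    w ^ 2 - 2 * x * w + 1 = (w - v) * (w - v⁻¹) := by
  rw [← hv]; field_simp; ring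

theorem sub_ne_zero_of_norm {v w : ℂ} (hv : ‖v‖ = 1) (hw : 1 < ‖w‖) :
    w ≠ 0 ∧ w - v ≠ 0 ∧ w - v⁻¹ ≠ 0 := by
  refine ⟨?_, ?_, ?_⟩
  · rintro rfl; norm_num at hw
  · intro h; rw [sub_eq_zero.1 h, hv] at hw; exact lt_irrefl _ hw
  · intro h; rw [sub_eq_zero.1 h, norm_inv, hv, inv_one] at hw; exact lt_irrefl _ hw

theorem chebKernel_eq {x : ℝ} {v : ℂ} (hv1 : ‖v‖ = 1) (hv0 : v ≠ 0) (hv : v + v⁻¹ = 2 * x) {w : ℂ}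
    (hw : 1 < ‖w‖) : chebKernel x w = (w - v)⁻¹ + (w - v⁻¹)⁻¹ - w⁻¹ := by
  obtain ⟨h0, h1, h2⟩ := sub_ne_zero_of_norm hv1 hw
  have e : w ^ 2 - 1 = w * ((w - v⁻¹) + (w - v)) - (w - v) * (w - v⁻¹) := by
    rw [← chebKernel_denom_eq hv0 hv w]
    linear_combination w * hv
  rw [chebKernel, chebKernel_denom_eq hv0 hv, e]
  generalize w - v⁻¹ = b at *
  generalize w - v = a at *
  field_simp

theorem continuousOn_chebKernel {x q : ℝ} (hx : |x| ≤ 1) (hq : 1 < q) :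
    ContinuousOn (chebKernel x) (sphere 0 q) := by
  obtain ⟨v, hv1, hv0, hv, -⟩ := exists_unit_of_abs_le_one hx
  refine ContinuousOn.div (by fun_prop) (by fun_prop) fun w hw => ?_
  obtain ⟨h0, h1, h2⟩ := sub_ne_zero_of_norm hv1 (w := w) (by simpa [← mem_sphere_zero_iff_norm.1 hw] using hq)
  rw [chebKernel_denom_eq hv0 hv]
  exact mul_ne_zero h0 (mul_ne_zero h1 h2)

/-- The factor `1` or `2` of the Chebyshev polynomials in their generating function. -/
def chebFactor (k : ℕ) : ℝ := if k = 0 then 1 else 2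

theorem hasSum_chebKernel {x : ℝ} (hx : |x| ≤ 1) {w : ℂ} (hw : 1 < ‖w‖) :
    HasSum (fun k : ℕ => (chebFactor k : ℂ) * (((Polynomial.Chebyshev.T ℝ k).eval x : ℝ) : ℂ) *
      w⁻¹ ^ (k + 1)) (chebKernel x w) := by
  obtain ⟨v, hv1, hv0, hv, hT⟩ := exists_unit_of_abs_le_one hx
  obtain ⟨h0, h1, h2⟩ := sub_ne_zero_of_norm hv1 hw
  have geo : ∀ u : ℂ, ‖u‖ = 1 → w - u ≠ 0 → HasSum (fun k : ℕ => u ^ k * w⁻¹ ^ (k + 1)) (w - u)⁻¹ := by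
    intro u hu hne
    have : HasSum (fun k : ℕ => (u * w⁻¹) ^ k) (1 - u * w⁻¹)⁻¹ := by
      apply hasSum_geometric_of_norm_lt_one
      rw [norm_mul, norm_inv, hu, one_mul]
      exact inv_lt_one_of_one_lt₀ hw
    have e : (w - u)⁻¹ = w⁻¹ * (1 - u * w⁻¹)⁻¹ := by
      rw [← mul_inv]; congr 1; field_simp
    have e' : (fun k : ℕ => u ^ k * w⁻¹ ^ (k + 1)) = fun k => w⁻¹ * (u * w⁻¹) ^ k := by
      ext k; rw [mul_pow, pow_succ]; ring
    rw [e, e']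
    exact this.mul_left w⁻¹
  have hs := ((geo v hv1 h1).add (geo v⁻¹ (by rw [norm_inv, hv1, inv_one]) h2)).sub
    (hasSum_ite_eq 0 w⁻¹)
  rw [chebKernel_eq hv1 hv0 hv hw]
  refine hs.congr_fun fun k => ?_
  rw [hT, chebFactor]
  rcases Nat.eq_zero_or_pos k with rfl | hk
  · simp
  · rw [if_neg hk.ne', if_neg hk.ne']
    push_cast
    ring

theorem circleIntegral_chebKernel {x q : ℝ} (hx : |x| ≤ 1) (hq : 1 < q) :
    ∮ w in C(0, q), chebKernel x w = 2 * Real.pi * I := by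
  obtain ⟨v, hv1, hv0, hv, -⟩ := exists_unit_of_abs_le_one hx
  have hq0 : 0 ≤ q := by linarith
  have hw : ∀ w ∈ sphere (0 : ℂ) q, 1 < ‖w‖ := fun w hw => by
    rwa [mem_sphere_zero_iff_norm.1 hw]
  rw [circleIntegral.integral_congr hq0 fun w h => chebKernel_eq hv1 hv0 hv (hw w h)]
  have hint : ∀ u : ℂ, ‖u‖ < q → CircleIntegrable (fun w => (w - u)⁻¹) 0 q := by
    intro u hu
    refine ContinuousOn.circleIntegrable hq0 (ContinuousOn.inv₀ (by fun_prop) fun w h e => ?_)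
    rw [sub_eq_zero.1 e] at h
    exact hu.ne (mem_sphere_zero_iff_norm.1 h)
  have hval : ∀ u : ℂ, ‖u‖ < q → ∮ w in C(0, q), (w - u)⁻¹ = 2 * Real.pi * I := fun u hu =>
    circleIntegral.integral_sub_inv_of_mem_ball (by simpa using hu)
  have hv' : ‖v⁻¹‖ < q := by rw [norm_inv, hv1, inv_one]; exact hq
  have h0 : ‖(0 : ℂ)‖ < q := by rw [norm_zero]; linarith
  have i0 := hint 0 h0
  have v0 := hval 0 h0
  simp only [sub_zero] at i0 v0
  have i1 : CircleIntegrable (fun w => (w - v)⁻¹ + (w - v⁻¹)⁻¹) 0 q :=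
    (hint v (hv1 ▸ hq)).add (hint _ hv')
  rw [circleIntegral.integral_sub i1 i0,
    circleIntegral.integral_add (hint v (hv1 ▸ hq)) (hint _ hv'), hval v (hv1 ▸ hq), hval _ hv', v0]
  ring

/-- Integrals of functions that are odd under `w ↦ w⁻¹` over the unit circle, with respect to
`dw / w`, vanish. -/
theorem circleIntegral_eq_zero_of_odd {G : ℂ → ℂ} (hG : ∀ w, G w⁻¹ = -G w) :
    ∮ w in C(0, 1), (w - 0)⁻¹ • G w = 0 := by
  have e : ∀ θ : ℝ, deriv (circleMap 0 1) θ • ((circleMap 0 1 θ - 0)⁻¹ • G (circleMap 0 1 θ)) =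
      I * G (circleMap 0 1 θ) := by
    intro θ
    have : circleMap 0 1 θ ≠ 0 := circleMap_ne_center one_ne_zero
    rw [deriv_circleMap, sub_zero, smul_eq_mul, smul_eq_mul]
    field_simp
  rw [circleIntegral]
  simp only [e]
  rw [intervalIntegral.integral_const_mul]
  have h1 : ∫ θ in (0 : ℝ)..2 * Real.pi, G (circleMap 0 1 (2 * Real.pi - θ)) =
      ∫ θ in (0 : ℝ)..2 * Real.pi, G (circleMap 0 1 θ) := by
    rw [intervalIntegral.integral_comp_sub_left fun θ => G (circleMap 0 1 θ)]
    simp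
  have h2 : ∀ θ : ℝ, G (circleMap 0 1 (2 * Real.pi - θ)) = -G (circleMap 0 1 θ) := by
    intro θ
    rw [← hG]
    congr 1
    simp only [circleMap, ofReal_one, one_mul, zero_add]
    rw [← exp_neg]
    push_cast
    rw [sub_mul, exp_sub, exp_two_pi_mul_I, exp_neg, one_div]
  simp only [h2, intervalIntegral.integral_neg] at h1
  rw [self_eq_neg.1 h1.symm, mul_zero]

theorem joukowski_inv (w : ℂ) : joukowski w⁻¹ = joukowski w := by
  rw [joukowski, joukowski, inv_inv, add_comm]

theorem differentiableAt_joukowski {w : ℂ} (hw : w ≠ 0) : DifferentiableAt ℂ joukowski w := by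
  unfold joukowski
  fun_prop (disch := assumption)

/-- The reproducing property of the Chebyshev kernel.  After `φ x` is subtracted, the integrand is
analytic in the whole annulus, so the circle can be shrunk to the unit circle, where the integral
vanishes by the symmetry `w ↦ w⁻¹`. -/
theorem circleIntegral_mul_chebKernel {φ : ℂ → ℂ} {q : ℝ} (hq : 1 < q)
    (hφ : AnalyticOnNhd ℂ φ (bernsteinEllipse q)) {x : ℝ} (hx : |x| ≤ 1) :
    ∮ w in C(0, q), φ (joukowski w) * chebKernel x w = 2 * Real.pi * I * φ x := by
  obtain ⟨v, hv1, hv0, hv, -⟩ := exists_unit_of_abs_le_one hx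
  have hq0 : 0 ≤ q := by linarith
  set U : Set ℂ := {z | AnalyticAt ℂ φ z} with hU
  have hUo : IsOpen U := isOpen_analyticAt ℂ φ
  have hJv : joukowski v = x := by rw [joukowski, hv]; ring
  have hxU : (x : ℂ) ∈ U := hφ _ ⟨v, ⟨hv1.ge, by rw [hv1]; exact hq.le⟩, hJv⟩
  have hdiff : DifferentiableOn ℂ (dslope φ x) U :=
    (differentiableOn_dslope (hUo.mem_nhds hxU)).2 fun z hz => hz.differentiableAt.differentiableWithinAt
  set G : ℂ → ℂ := fun w => dslope φ x (joukowski w) * ((w - w⁻¹) / 2) with hG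
  have hodd : ∀ w, G w⁻¹ = -G w := by
    intro w
    simp only [hG, joukowski_inv, inv_inv]
    ring
  have hGd : ∀ w : ℂ, 1 ≤ ‖w‖ → ‖w‖ ≤ q → DifferentiableAt ℂ G w := by
    intro w h1 h2
    have hw0 : w ≠ 0 := by rintro rfl; norm_num at h1
    have := hdiff.differentiableAt (hUo.mem_nhds (hφ _ ⟨w, ⟨h1, h2⟩, rfl⟩))
    have hc : DifferentiableAt ℂ (fun w => dslope φ x (joukowski w)) w :=
      this.comp w (differentiableAt_joukowski hw0)
    exact hc.mul (by fun_prop (disch := assumption))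
  have hann := circleIntegral_sub_center_inv_smul_eq_of_differentiable_on_annulus_off_countable
    (c := 0) (r := 1) (R := q) one_pos hq.le (f := G) Set.countable_empty
    (fun w hw => (hGd w (by simpa using hw.2) (by simpa using hw.1)).continuousAt.continuousWithinAt)
    (fun w hw => hGd w (by simpa using (le_of_lt (not_le.1 (by simpa using hw.1.2))))
      (by simpa using (mem_ball.1 hw.1.1).le))
  rw [circleIntegral_eq_zero_of_odd hodd] at hann
  -- `(w - w⁻¹) / 2` divided by `joukowski w - x` is `w` times the kernel.
  have hsplit : ∀ w ∈ sphere (0 : ℂ) q,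
      φ (joukowski w) * chebKernel x w = (w - 0)⁻¹ • G w + φ x * chebKernel x w := by
    intro w hw
    obtain ⟨h0, h1, h2⟩ := sub_ne_zero_of_norm hv1 (w := w) (by rwa [mem_sphere_zero_iff_norm.1 hw])
    have e : joukowski w - x = (w - v) * (w - v⁻¹) / (2 * w) := by
      rw [← chebKernel_denom_eq hv0 hv, joukowski]; field_simp; ring
    have hne : joukowski w ≠ x := by
      rw [← sub_ne_zero, e]
      exact div_ne_zero (mul_ne_zero h1 h2) (mul_ne_zero two_ne_zero h0)
    simp only [hG, sub_zero, smul_eq_mul]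
    rw [dslope_of_ne _ hne, slope_def_field, e, chebKernel, chebKernel_denom_eq hv0 hv]
    generalize w - v⁻¹ = b at *
    generalize w - v = a at *
    field_simp
    ring
  rw [circleIntegral.integral_congr hq0 hsplit, circleIntegral.integral_add, hann,
    circleIntegral.integral_const_mul, circleIntegral_chebKernel hx hq]
  · ring
  · refine ContinuousOn.circleIntegrable hq0 fun w hw => ?_
    have hw' := mem_sphere_zero_iff_norm.1 hw
    have h0 : w ≠ 0 := by rintro rfl; rw [norm_zero] at hw'; linarith
    have h1 : ContinuousAt (fun w : ℂ => (w - 0)⁻¹) w :=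
      ContinuousAt.inv₀ (by fun_prop) (by simpa using h0)
    exact (h1.smul (hGd w (hw' ▸ hq.le) hw'.le).continuousAt).continuousWithinAt
  · exact ((continuousOn_chebKernel hx hq).const_smul (φ x)).circleIntegrable hq0

end Kernel

/-! ### Polynomial approximation on products of Bernstein ellipses -/

section PolyEllipse

open Complex Metric

/-- The product of `d` Bernstein ellipses. -/
def polyEllipse (d : ℕ) (q : ℝ) : Set (Fin d → ℂ) := Set.univ.pi fun _ => bernsteinEllipse q

/-- The distinguished boundary of the polydisc of radius `q`. -/
def torusSet (d : ℕ) (q : ℝ) : Set (Fin d → ℂ) := Set.univ.pi fun _ => sphere 0 q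

theorem torusMap_mem_torusSet {d : ℕ} {q : ℝ} (hq : 0 ≤ q) (θ : Fin d → ℝ) :
    torusMap 0 (fun _ => q) θ ∈ torusSet d q := by
  intro i _
  simp [torusMap, norm_exp_ofReal_mul_I, abs_of_nonneg hq]

theorem torusIntegrable_of_continuousOn {d : ℕ} {q : ℝ} (hq : 0 ≤ q) {g : (Fin d → ℂ) → ℂ}
    (hg : ContinuousOn g (torusSet d q)) : TorusIntegrable g 0 fun _ => q := by
  refine Continuous.integrableOn_Icc ?_
  refine hg.comp_continuous ?_ (torusMap_mem_torusSet hq)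
  unfold torusMap
  fun_prop

theorem torusIntegral_congr {d : ℕ} {q : ℝ} (hq : 0 ≤ q) {g g' : (Fin d → ℂ) → ℂ}
    (h : Set.EqOn g g' (torusSet d q)) :
    (∯ w in T(0, fun _ => q), g w) = ∯ w in T(0, fun _ => q), g' w := by
  simp only [torusIntegral, h (torusMap_mem_torusSet hq _)]

theorem torusIntegral_sum {d : ℕ} {q : ℝ} (hq : 0 ≤ q) {α : Type*} (s : Finset α)
    {g : α → (Fin d → ℂ) → ℂ} (hg : ∀ a ∈ s, ContinuousOn (g a) (torusSet d q)) :
    (∯ w in T(0, fun _ => q), ∑ a ∈ s, g a w) = ∑ a ∈ s, ∯ w in T(0, fun _ => q), g a w := by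
  simp only [torusIntegral, Finset.smul_sum]
  exact MeasureTheory.integral_finsetSum _ fun a ha =>
    (torusIntegrable_of_continuousOn hq (hg a ha)).function_integrable

theorem joukowski_mem_polyEllipse {d : ℕ} {q : ℝ} (hq : 1 ≤ q) {w : Fin d → ℂ}
    (hw : w ∈ torusSet d q) : (fun i => joukowski (w i)) ∈ polyEllipse d q := fun i hi =>
  have h := mem_sphere_zero_iff_norm.1 (hw i hi)
  ⟨w i, ⟨h.symm ▸ hq, h.le⟩, rfl⟩

theorem continuousOn_comp_joukowski {d : ℕ} {q : ℝ} (hq : 1 ≤ q) {F : (Fin d → ℂ) → ℂ}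
    (hF : ContinuousOn F (polyEllipse d q)) :
    ContinuousOn (fun w => F fun i => joukowski (w i)) (torusSet d q) := by
  refine hF.comp (fun w hw => ?_) fun w hw => joukowski_mem_polyEllipse hq hw
  refine ContinuousAt.continuousWithinAt (continuousAt_pi.2 fun i => ?_)
  have hwi : w i ≠ 0 := by
    intro h
    have := mem_sphere_zero_iff_norm.1 (hw i trivial)
    rw [h, norm_zero] at this
    linarith
  exact ContinuousAt.comp (f := fun w : Fin d → ℂ => w i)
    (differentiableAt_joukowski hwi).continuousAt (continuousAt_apply i w)

theorem continuousOn_prod_apply {d : ℕ} {q : ℝ} {g : Fin d → ℂ → ℂ}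
    (hg : ∀ i, ContinuousOn (g i) (sphere 0 q)) :
    ContinuousOn (fun w : Fin d → ℂ => ∏ i, g i (w i)) (torusSet d q) :=
  continuousOn_finsetProd _ fun i _ =>
    (hg i).comp (continuous_apply i).continuousOn fun _ hw => hw i trivial

/-- The reproducing property of the product kernel, by Fubini's theorem. -/
theorem torusIntegral_mul_chebKernel {q : ℝ} (hq : 1 < q) :
    ∀ (d : ℕ) {F : (Fin d → ℂ) → ℂ}, AnalyticOnNhd ℂ F (polyEllipse d q) →
      ∀ {x : Fin d → ℝ}, (∀ i, |x i| ≤ 1) →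
      (∯ w in T(0, fun _ => q), F (fun i => joukowski (w i)) * ∏ i, chebKernel (x i) (w i)) =
        (2 * Real.pi * I) ^ d * F fun i => x i := by
  have hq0 : 0 ≤ q := by linarith
  intro d
  induction d with
  | zero =>
    intro F _ x _
    rw [torusIntegral_dim0]
    simp only [univ_eq_empty, prod_empty, mul_one, pow_zero, one_mul]
    congr 1
    exact Subsingleton.elim _ _
  | succ d ih =>
    intro F hF x hx
    have hmem : ∀ z : ℂ, z ∈ bernsteinEllipse q → ∀ y ∈ polyEllipse d q,
        (Fin.cons z y : Fin (d + 1) → ℂ) ∈ polyEllipse (d + 1) q := by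
      intro z hz y hy i _
      refine Fin.cases ?_ (fun j => ?_) i
      · simpa using hz
      · simpa using hy j trivial
    have hreal : ∀ y : Fin d → ℝ, (∀ i, |y i| ≤ 1) → (fun i => (y i : ℂ)) ∈ polyEllipse d q := by
      intro y hy i _
      obtain ⟨v, hv1, -, hv, -⟩ := exists_unit_of_abs_le_one (hy i)
      exact ⟨v, ⟨hv1.ge, by rw [hv1]; exact hq.le⟩, by rw [joukowski, hv]; ring⟩
    rw [torusIntegral_succ (torusIntegrable_of_continuousOn hq0
      ((continuousOn_comp_joukowski hq.le hF.continuousOn).fun_mul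
        (continuousOn_prod_apply fun i => continuousOn_chebKernel (hx i) hq)))]
    have inner : ∀ w ∈ sphere (0 : ℂ) q,
        (∯ y in T((0 : Fin (d + 1) → ℂ) ∘ Fin.succ, (fun _ => q) ∘ Fin.succ),
          F (fun i => joukowski ((Fin.cons w y : Fin (d + 1) → ℂ) i)) *
            ∏ i, chebKernel (x i) ((Fin.cons w y : Fin (d + 1) → ℂ) i)) =
        (2 * Real.pi * I) ^ d *
          (F (Fin.cons (joukowski w) fun i => (x i.succ : ℂ)) * chebKernel (x 0) w) := by
      intro w hw
      have hw' := mem_sphere_zero_iff_norm.1 hw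
      have hJ : joukowski w ∈ bernsteinEllipse q := ⟨w, ⟨hw' ▸ hq.le, hw'.le⟩, rfl⟩
      have hF' : AnalyticOnNhd ℂ (fun y : Fin d → ℂ => F (Fin.cons (joukowski w) y))
          (polyEllipse d q) := by
        intro y hy
        refine (hF _ (hmem _ hJ y hy)).comp_of_eq ?_ rfl
        refine AnalyticAt.pi fun i => ?_
        refine Fin.cases ?_ (fun j => ?_) i
        · simpa using analyticAt_const
        · simp only [Fin.cons_succ]
          exact (ContinuousLinearMap.proj (R := ℂ) (φ := fun _ : Fin d => ℂ) j).analyticAt y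
      have h := ih hF' (x := fun i => x i.succ) fun i => hx i.succ
      rw [← mul_assoc, ← h, mul_comm, ← torusIntegral_const_mul]
      refine torusIntegral_congr hq0 fun y _ => ?_
      simp only [Fin.prod_univ_succ, Fin.cons_zero, Fin.cons_succ]
      have : (fun i => joukowski ((Fin.cons w y : Fin (d + 1) → ℂ) i)) =
          Fin.cons (joukowski w) fun i => joukowski (y i) := by
        ext i
        refine Fin.cases ?_ (fun j => ?_) i <;> simp
      rw [this]
      ring
    refine (circleIntegral.integral_congr hq0 inner).trans ?_
    rw [circleIntegral.integral_const_mul]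
    have hF1 : AnalyticOnNhd ℂ (fun z : ℂ => F (Fin.cons z fun i => (x i.succ : ℂ)))
        (bernsteinEllipse q) := by
      intro z hz
      refine (hF _ (hmem _ hz _ (hreal _ fun i => hx i.succ))).comp_of_eq ?_ rfl
      refine AnalyticAt.pi fun i => ?_
      refine Fin.cases ?_ (fun j => ?_) i
      · simp only [Fin.cons_zero]
        exact analyticAt_id
      · simpa using analyticAt_const
    have hcons : (Fin.cons (x 0 : ℂ) fun i : Fin d => (x i.succ : ℂ)) =
        fun i : Fin (d + 1) => (x i : ℂ) := by
      ext i
      refine Fin.cases ?_ (fun j => ?_) i <;> simp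
    rw [circleIntegral_mul_chebKernel hq hF1 (hx 0), hcons, pow_succ]
    ring

theorem norm_chebTerm_le {d : ℕ} {q : ℝ} (hq : 0 < q) {w : Fin d → ℂ} (hw : w ∈ torusSet d q)
    (k : Fin d → ℕ) :
    ‖∏ i, ((chebFactor (k i) : ℂ) * (w i)⁻¹ ^ (k i + 1))‖ ≤
      2 ^ d * (q⁻¹ ^ (∑ i, k i) * q⁻¹ ^ d) := by
  rw [norm_prod, ← prod_pow_eq_pow_sum]
  calc _ ≤ ∏ i : Fin d, (2 * (q⁻¹ ^ k i * q⁻¹)) := by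
        refine prod_le_prod (fun _ _ => norm_nonneg _) fun i _ => ?_
        rw [norm_mul, norm_pow, norm_inv, mem_sphere_zero_iff_norm.1 (hw i trivial), pow_succ,
          norm_real, Real.norm_eq_abs]
        gcongr
        rw [chebFactor]; split_ifs <;> norm_num
    _ = _ := by simp [prod_mul_distrib]

/-- Truncating the product kernel at total degree `n` costs at most a tail of the geometric series,
on the torus and on the cube. -/
theorem norm_chebKernel_sub_le {d : ℕ} {q τ : ℝ} (hq : 1 < q) {n : ℕ}
    (hτ : ∀ L, ∑ k ∈ (Fintype.piFinset fun _ : Fin d => range L).filter (fun k => n < ∑ i, k i),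
        (q⁻¹) ^ ∑ i, k i ≤ τ) {x : Fin d → ℝ} (hx : ∀ i, |x i| ≤ 1)
    {w : Fin d → ℂ} (hw : w ∈ torusSet d q) :
    ‖∏ i, chebKernel (x i) (w i) - ∑ k ∈ multiIdx d n,
      (∏ i, ((chebFactor (k i) : ℂ) * (w i)⁻¹ ^ (k i + 1))) *
        ((∏ i, (Polynomial.Chebyshev.T ℝ (k i)).eval (x i) : ℝ) : ℂ)‖ ≤ 2 ^ d * (τ * q⁻¹ ^ d) := by
  have hq0 : 0 < q := by linarith
  have hT : ∀ k : Fin d → ℕ,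
      ‖((∏ i, (Polynomial.Chebyshev.T ℝ (k i)).eval (x i) : ℝ) : ℂ)‖ ≤ 1 := by
    intro k
    rw [norm_real, Real.norm_eq_abs, abs_prod]
    exact prod_le_one (fun _ _ => abs_nonneg _) fun i _ =>
      Polynomial.Chebyshev.abs_eval_T_real_le_one _ (hx i)
  set term : (Fin d → ℕ) → ℂ := fun k => (∏ i, ((chebFactor (k i) : ℂ) * (w i)⁻¹ ^ (k i + 1))) *
        ((∏ i, (Polynomial.Chebyshev.T ℝ (k i)).eval (x i) : ℝ) : ℂ) with hterm
  -- The partial sums over boxes are products of one-dimensional partial sums.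
  have hlim : Filter.Tendsto (fun L => ∑ k ∈ Fintype.piFinset fun _ : Fin d => range L, term k)
      Filter.atTop (nhds (∏ i, chebKernel (x i) (w i))) := by
    have : ∀ L, ∑ k ∈ Fintype.piFinset (fun _ : Fin d => range L), term k =
        ∏ i, ∑ j ∈ range L, (chebFactor j : ℂ) *
          (((Polynomial.Chebyshev.T ℝ j).eval (x i) : ℝ) : ℂ) * (w i)⁻¹ ^ (j + 1) := by
      intro L
      rw [prod_univ_sum]
      refine sum_congr rfl fun k _ => ?_
      rw [hterm]
      push_cast
      rw [← prod_mul_distrib]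
      exact prod_congr rfl fun i _ => by ring
    simp only [this]
    refine tendsto_finsetProd _ fun i _ => (hasSum_chebKernel (hx i) ?_).tendsto_sum_nat
    rwa [mem_sphere_zero_iff_norm.1 (hw i trivial)]
  refine le_of_tendsto (hlim.sub_const _).norm ?_
  filter_upwards [Filter.eventually_ge_atTop (n + 1)] with L hL
  have hsub : multiIdx d n =
      (Fintype.piFinset fun _ : Fin d => range L).filter fun k => ¬ n < ∑ i, k i := by
    ext k
    simp only [mem_multiIdx, mem_filter, Fintype.mem_piFinset, mem_range, not_lt]
    refine ⟨fun h => ⟨fun i => ?_, h⟩, fun h => h.2⟩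
    have : k i ≤ n := (single_le_sum (fun _ _ => Nat.zero_le _) (mem_univ i)).trans h
    omega
  rw [hsub, ← sum_filter_add_sum_filter_not _ fun k : Fin d → ℕ => n < ∑ i, k i, add_sub_cancel_right]
  calc _ ≤ ∑ k ∈ (Fintype.piFinset fun _ : Fin d => range L).filter (fun k => n < ∑ i, k i),
        2 ^ d * (q⁻¹ ^ (∑ i, k i) * q⁻¹ ^ d) := by
        refine norm_sum_le_of_le _ fun k _ => ?_
        rw [hterm, norm_mul]
        exact (mul_le_of_le_one_right (norm_nonneg _) (hT k)).trans (norm_chebTerm_le hq0 hw k)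
    _ ≤ _ := by
        rw [← mul_sum, ← sum_mul]
        gcongr
        exact hτ L

/-- The Chebyshev expansion of a function that is analytic and bounded by `M` on a product of
Bernstein ellipses, truncated at total degree `n`. -/
theorem exists_chebyshev_approx {d : ℕ} {q τ M : ℝ} (hq : 1 < q) {n : ℕ}
    (hτ : ∀ L, ∑ k ∈ (Fintype.piFinset fun _ : Fin d => range L).filter (fun k => n < ∑ i, k i),
        (q⁻¹) ^ ∑ i, k i ≤ τ) {F : (Fin d → ℂ) → ℂ} (hF : AnalyticOnNhd ℂ F (polyEllipse d q))
    (hM : ∀ z ∈ polyEllipse d q, ‖F z‖ ≤ M) :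
    ∃ A : (Fin d → ℕ) → ℂ, (∀ k, ‖A k‖ ≤ 2 ^ d * M * q⁻¹ ^ ∑ i, k i) ∧
      ∀ x : Fin d → ℝ, (∀ i, |x i| ≤ 1) →
        ‖F (fun i => x i) - ∑ k ∈ multiIdx d n,
          A k * ((∏ i, (Polynomial.Chebyshev.T ℝ (k i)).eval (x i) : ℝ) : ℂ)‖ ≤
          2 ^ d * M * τ := by
  have hq0 : 0 < q := by linarith
  have hpi : (2 * Real.pi * I : ℂ) ≠ 0 := two_pi_I_ne_zero
  have hpin : ‖(2 * Real.pi * I : ℂ)‖ = 2 * Real.pi := by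
    simp [abs_of_pos Real.pi_pos]
  have hpi0 := Real.pi_pos
  -- The normalised torus integral is an average against `∏ w i`, of modulus `q ^ d`.
  have hest : ∀ (g : (Fin d → ℂ) → ℂ) (c : ℝ), (∀ w ∈ torusSet d q, ‖g w‖ ≤ c * q⁻¹ ^ d) →
      ‖((2 * Real.pi * I : ℂ) ^ d)⁻¹ * ∯ w in T(0, fun _ => q), g w‖ ≤ c := by
    intro g c hg
    have h := norm_torusIntegral_le_of_norm_le_const (f := g) (c := 0) (R := fun _ => q)
      fun θ => hg _ (torusMap_mem_torusSet hq0.le θ)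
    rw [norm_mul, norm_inv, norm_pow, hpin]
    refine (mul_le_mul_of_nonneg_left h (by positivity)).trans_eq ?_
    simp only [prod_const, card_univ, Fintype.card_fin, abs_of_pos hq0, inv_pow]
    field_simp
  have hFc := continuousOn_comp_joukowski hq.le hF.continuousOn
  have hterm : ∀ k : Fin d → ℕ, ContinuousOn
      (fun w : Fin d → ℂ => ∏ i, ((chebFactor (k i) : ℂ) * (w i)⁻¹ ^ (k i + 1))) (torusSet d q) := by
    intro k
    refine continuousOn_prod_apply (g := fun i w => (chebFactor (k i) : ℂ) * w⁻¹ ^ (k i + 1))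
      fun i => continuousOn_const.mul (ContinuousOn.pow (ContinuousOn.inv₀ continuousOn_id
        fun w hw h => ?_) _)
    have := mem_sphere_zero_iff_norm.1 hw
    rw [show w = 0 from h, norm_zero] at this
    linarith
  refine ⟨fun k => ((2 * Real.pi * I : ℂ) ^ d)⁻¹ * ∯ w in T(0, fun _ => q),
    F (fun i => joukowski (w i)) * ∏ i, ((chebFactor (k i) : ℂ) * (w i)⁻¹ ^ (k i + 1)), fun k => ?_,
    fun x hx => ?_⟩
  · refine hest _ _ fun w hw => ?_
    have hFw := hM _ (joukowski_mem_polyEllipse hq.le hw)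
    rw [norm_mul]
    refine (mul_le_mul hFw (norm_chebTerm_le hq0 hw k) (norm_nonneg _)
      ((norm_nonneg _).trans hFw)).trans_eq ?_
    ring
  · have hrep := torusIntegral_mul_chebKernel hq d hF hx
    have hsum : ∑ k ∈ multiIdx d n, (((2 * Real.pi * I : ℂ) ^ d)⁻¹ * ∯ w in T(0, fun _ => q),
        F (fun i => joukowski (w i)) * ∏ i, ((chebFactor (k i) : ℂ) * (w i)⁻¹ ^ (k i + 1))) *
          ((∏ i, (Polynomial.Chebyshev.T ℝ (k i)).eval (x i) : ℝ) : ℂ) =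
        ((2 * Real.pi * I : ℂ) ^ d)⁻¹ * ∯ w in T(0, fun _ => q), F (fun i => joukowski (w i)) *
          ∑ k ∈ multiIdx d n, (∏ i, ((chebFactor (k i) : ℂ) * (w i)⁻¹ ^ (k i + 1))) *
          ((∏ i, (Polynomial.Chebyshev.T ℝ (k i)).eval (x i) : ℝ) : ℂ) := by
      simp only [mul_sum]
      rw [torusIntegral_sum hq0.le _ fun k _ => hFc.fun_mul ((hterm k).fun_mul continuousOn_const), mul_sum]
      refine sum_congr rfl fun k _ => ?_
      rw [mul_assoc, mul_comm (torusIntegral _ _ _), ← torusIntegral_const_mul]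
      congr 2
      ext w
      ring
    have hF0 : F (fun i => x i) = ((2 * Real.pi * I : ℂ) ^ d)⁻¹ *
        ∯ w in T(0, fun _ => q), F (fun i => joukowski (w i)) * ∏ i, chebKernel (x i) (w i) := by
      rw [hrep, inv_mul_cancel_left₀ (pow_ne_zero _ hpi)]
    rw [hsum, hF0, ← mul_sub, ← torusIntegral_sub]
    · refine hest _ _ fun w hw => ?_
      have hFw := hM _ (joukowski_mem_polyEllipse hq.le hw)
      rw [← mul_sub, norm_mul]
      refine (mul_le_mul hFw (norm_chebKernel_sub_le hq hτ hx hw) (norm_nonneg _)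
        ((norm_nonneg _).trans hFw)).trans_eq ?_
      ring
    · exact torusIntegrable_of_continuousOn hq0.le
        (hFc.mul (continuousOn_prod_apply fun i => continuousOn_chebKernel (hx i) hq))
    · exact torusIntegrable_of_continuousOn hq0.le
        (hFc.mul (continuousOn_finsetSum _ fun k _ => (hterm k).mul continuousOn_const))

end PolyEllipse

/-! ### The two regions -/

open Complex in
/-- The parameters of a Bernstein ellipse, seen through the map `z ↦ z ^ 2`. -/
theorem norm_sq_add_le_of_mem_bernsteinEllipse {q : ℝ} {z : ℂ} (hz : z ∈ bernsteinEllipse q) :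
    ‖z ^ 2‖ + ‖z ^ 2 - 1‖ ≤ 1 + 2 * ((q - q⁻¹) / 2) ^ 2 := by
  obtain ⟨w, ⟨h1, h2⟩, rfl⟩ := hz
  have hw0 : w ≠ 0 := by rintro rfl; norm_num at h1
  have e1 : joukowski w ^ 2 = ((w + w⁻¹) / 2) ^ 2 := rfl
  have e2 : joukowski w ^ 2 - 1 = ((w - w⁻¹) / 2) ^ 2 := by
    rw [e1]; field_simp; ring
  rw [e2, e1, norm_pow, norm_pow, norm_div, norm_div]
  have hp := parallelogram_law_with_norm ℝ w w⁻¹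
  rw [norm_inv] at hp
  have h0 : 0 < ‖w‖ := by linarith
  have hi : ‖w‖ * ‖w‖⁻¹ = 1 := mul_inv_cancel₀ h0.ne'
  have hi1 : ‖w‖⁻¹ ≤ 1 := inv_le_one_of_one_le₀ h1
  have hi2 : q⁻¹ ≤ ‖w‖⁻¹ := inv_anti₀ h0 h2
  have hsq : (‖w‖ - ‖w‖⁻¹) ^ 2 ≤ (q - q⁻¹) ^ 2 :=
    pow_le_pow_left₀ (by linarith) (by linarith) 2
  have h22 : ‖(2 : ℂ)‖ = 2 := by simp
  rw [h22]
  nlinarith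

theorem polyEllipse_subset_complexEllipse {d : ℕ} {q ρ : ℝ}
    (h : (d : ℝ) * ((q - q⁻¹) / 2) ^ 2 ≤ ((ρ - ρ⁻¹) / 2) ^ 2) :
    polyEllipse d q ⊆ complexEllipse d ρ := by
  intro z hz
  have hs : ∑ i, z i ^ 2 - (d : ℂ) = ∑ i, (z i ^ 2 - 1) := by simp
  have := sum_le_sum fun i (_ : i ∈ univ) => norm_sq_add_le_of_mem_bernsteinEllipse (hz i trivial)
  rw [sum_add_distrib, sum_const, card_univ, Fintype.card_fin, nsmul_eq_mul, mul_add] at this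
  rw [complexEllipse, Set.mem_ofPred_eq, hs]
  refine (add_le_add (norm_sum_le _ _) (norm_sum_le _ _)).trans (this.trans ?_)
  linarith

theorem polyEllipse_subset_normEllipse {d : ℕ} (hd : 1 ≤ d) {q ρ : ℝ}
    (h : (d : ℝ) * ((q - q⁻¹) / 2) ^ 2 ≤ ((ρ - ρ⁻¹) / 2) ^ 2) :
    polyEllipse d q ⊆ normEllipse d ρ := by
  intro z hz
  have hd' : (1 : ℝ) ≤ d := by exact_mod_cast hd
  have hi : ∀ i, ‖z i‖ ^ 2 ≤ 1 + ((q - q⁻¹) / 2) ^ 2 := by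
    intro i
    have h1 := norm_sq_add_le_of_mem_bernsteinEllipse (hz i trivial)
    have h2 : ‖z i ^ 2‖ ≤ ‖z i ^ 2 - 1‖ + 1 := by
      have h := norm_add_le (z i ^ 2 - 1) 1
      rwa [sub_add_cancel, norm_one] at h
    rw [← norm_pow]
    linarith
  have hsum : ∑ i, ‖z i‖ ^ 2 ≤ d + ((ρ - ρ⁻¹) / 2) ^ 2 := by
    refine (sum_le_sum fun i _ => hi i).trans ?_
    rw [sum_const, card_univ, Fintype.card_fin, nsmul_eq_mul, mul_add]
    linarith
  have hn : complexNorm z ≤ d + ((ρ - ρ⁻¹) / 2) ^ 2 := by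
    have hpos := sq_nonneg ((ρ - ρ⁻¹) / 2)
    rw [complexNorm, Real.sqrt_le_left (by positivity)]
    refine hsum.trans ?_
    nlinarith
  have hn0 : 0 ≤ complexNorm z := Real.sqrt_nonneg _
  rw [normEllipse, Set.mem_ofPred_eq]
  rcases abs_cases (complexNorm z - d) with ⟨e, -⟩ | ⟨e, -⟩ <;> rw [e] <;>
    nlinarith [sq_nonneg ((ρ - ρ⁻¹) / 2)]

theorem mul_sinh_lt_sinh_mul {a t : ℝ} (ha : 1 < a) (ht : 0 < t) :
    a * Real.sinh t < Real.sinh (a * t) := by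
  have hmono : StrictMonoOn (fun s => Real.sinh (a * s) - a * Real.sinh s) (Set.Ici 0) := by
    refine strictMonoOn_of_deriv_pos (convex_Ici 0) (by fun_prop) fun s hs => ?_
    rw [interior_Ici, Set.mem_Ioi] at hs
    have h1 : HasDerivAt (fun s => Real.sinh (a * s) - a * Real.sinh s)
        (Real.cosh (a * s) * (a * 1) - a * Real.cosh s) s :=
      (((hasDerivAt_id s).const_mul a).sinh).sub ((Real.hasDerivAt_sinh s).const_mul a)
    rw [h1.deriv]
    have h2 : Real.cosh s < Real.cosh (a * s) := by
      rw [Real.cosh_lt_cosh, abs_of_pos hs, abs_of_pos (by positivity)]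
      nlinarith
    nlinarith
  have := hmono Set.self_mem_Ici ht.le ht
  simp only [mul_zero, Real.sinh_zero, sub_zero] at this
  linarith

/-- A product of equal Bernstein ellipses fits into the regions with a parameter `q` at least
`β = ρ ^ (1 / √d)`, and with `q > β` if `d ≥ 2`. -/
theorem exists_ellipse_parameter {d : ℕ} (hd : 1 ≤ d) {β ρ : ℝ} (hβ : 1 < β)
    (hρ : ρ = β ^ √(d : ℝ)) :
    ∃ q : ℝ, β ≤ q ∧ (β < q ∨ d = 1 ∧ q = β) ∧
      (d : ℝ) * ((q - q⁻¹) / 2) ^ 2 ≤ ((ρ - ρ⁻¹) / 2) ^ 2 := by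
  rcases hd.eq_or_lt with rfl | hd2
  · refine ⟨β, le_rfl, Or.inr ⟨rfl, rfl⟩, ?_⟩
    simp [hρ]
  · have ha : 1 < √(d : ℝ) := by
      rw [Real.lt_sqrt zero_le_one]
      norm_num
      exact hd2
    have ht : 0 < Real.log β := Real.log_pos hβ
    have hβ0 : 0 < β := by linarith
    have hlt : √(d : ℝ) * ((β - β⁻¹) / 2) < (ρ - ρ⁻¹) / 2 := by
      have h := mul_sinh_lt_sinh_mul ha ht
      rw [Real.sinh_eq, Real.sinh_eq, Real.exp_neg, Real.exp_neg, Real.exp_log hβ0,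
        mul_comm (√(d : ℝ)) (Real.log β), ← Real.rpow_def_of_pos hβ0, ← hρ] at h
      exact h
    -- The inequality is strict at `β`, so it persists for some larger `q`.
    have hc : ContinuousAt (fun q : ℝ => √(d : ℝ) * ((q - q⁻¹) / 2)) β := by
      fun_prop (disch := exact hβ0.ne')
    obtain ⟨q, hq, hqβ⟩ := (((hc.eventually_lt continuousAt_const hlt).filter_mono
      nhdsWithin_le_nhds).and (self_mem_nhdsWithin (s := Set.Ioi β))).exists
    refine ⟨q, hqβ.le, Or.inl hqβ, ?_⟩
    have hq1 : q⁻¹ ≤ 1 := inv_le_one_of_one_le₀ (by linarith)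
    calc (d : ℝ) * ((q - q⁻¹) / 2) ^ 2 = (√(d : ℝ) * ((q - q⁻¹) / 2)) ^ 2 := by
          rw [mul_pow, Real.sq_sqrt (Nat.cast_nonneg d)]
      _ ≤ _ := pow_le_pow_left₀ (mul_nonneg (Real.sqrt_nonneg _) (by linarith)) hq.le 2

theorem isCompact_polyEllipse (d : ℕ) (q : ℝ) : IsCompact (polyEllipse d q) := by
  refine isCompact_univ_pi fun _ => IsCompact.image_of_continuousOn ?_ fun w hw => ?_
  · have : {w : ℂ | 1 ≤ ‖w‖ ∧ ‖w‖ ≤ q} = Metric.closedBall 0 q ∩ {w | 1 ≤ ‖w‖} := by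
      ext w; simp [and_comm]
    rw [this]
    exact (isCompact_closedBall 0 q).inter_right (isClosed_le continuous_const continuous_norm)
  · have hw0 : w ≠ 0 := by rintro rfl; have := hw.1; norm_num at this
    exact (differentiableAt_joukowski hw0).continuousAt.continuousWithinAt

/-! ### Width and height -/

theorem one_le_netHeight_and_pow_le {d : ℕ} (hd : 1 ≤ d) {ρ : ℝ} (hρ : 1 < ρ) {N : ℕ} (hN : 1 ≤ N) :
    1 ≤ netHeight d ρ N ∧ N * (1 / 4 : ℝ) ^ netHeight d ρ N ≤ ρ ^ (-(N : ℝ) / √(d : ℝ)) := by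
  have hd' : (1 : ℝ) ≤ d := by exact_mod_cast hd
  have hN' : (1 : ℝ) ≤ N := by exact_mod_cast hN
  have hρ0 : 0 < ρ := by linarith
  have h1 : 0 ≤ (d : ℝ) * Real.logb 2 (((N : ℝ) + 1) * (Real.exp 1 * ((N : ℝ) + d) / d)) := by
    refine mul_nonneg (by linarith) (Real.logb_nonneg one_lt_two ?_)
    have he : 1 ≤ Real.exp 1 := Real.one_le_exp zero_le_one
    have : 1 ≤ Real.exp 1 * ((N : ℝ) + d) / d := by
      rw [le_div_iff₀ (by linarith)]
      nlinarith
    nlinarith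
  have h2 : Real.logb 2 N + 2 < Real.logb 2 (6 * (N : ℝ)) := by
    have : Real.logb 2 N + 2 = Real.logb 2 (4 * N) := by
      rw [Real.logb_mul (by norm_num) (by linarith), show (4 : ℝ) = 2 ^ (2 : ℝ) by norm_num,
        Real.logb_rpow (by norm_num) (by norm_num), add_comm]
    rw [this]
    exact Real.logb_lt_logb one_lt_two (by linarith) (by linarith)
  have h3 : 0 ≤ Real.logb 2 (N : ℝ) := Real.logb_nonneg one_lt_two hN'
  have h4 : 0 ≤ (N : ℝ) / √(d : ℝ) * Real.logb 2 ρ :=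
    mul_nonneg (by positivity) (Real.logb_nonneg one_lt_two hρ.le)
  have hH := Nat.le_ceil (1 / 2 * ((d : ℝ) *
      Real.logb 2 (((N : ℝ) + 1) * (Real.exp 1 * ((N : ℝ) + d) / d))
      + Real.logb 2 (6 * (N : ℝ)) + (N : ℝ) / √(d : ℝ) * Real.logb 2 ρ - 2))
  rw [← netHeight] at hH
  constructor
  · have : (0 : ℝ) < netHeight d ρ N := by linarith
    exact_mod_cast this
  · have h5 : (N : ℝ) * ρ ^ ((N : ℝ) / √(d : ℝ)) ≤ 4 ^ netHeight d ρ N := by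
      have e1 : (N : ℝ) * ρ ^ ((N : ℝ) / √(d : ℝ)) =
          2 ^ (Real.logb 2 N + (N : ℝ) / √(d : ℝ) * Real.logb 2 ρ) := by
        rw [Real.rpow_add two_pos, Real.rpow_logb two_pos (by norm_num) (by linarith),
          mul_comm _ (Real.logb 2 ρ), Real.rpow_mul zero_le_two,
          Real.rpow_logb two_pos (by norm_num) hρ0]
      have e2 : (4 : ℝ) ^ netHeight d ρ N = 2 ^ (2 * (netHeight d ρ N : ℝ)) := by
        rw [Real.rpow_mul zero_le_two, Real.rpow_natCast]; norm_num
      rw [e1, e2]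
      exact Real.rpow_le_rpow_of_exponent_le one_le_two (by linarith)
    rw [neg_div, Real.rpow_neg hρ0.le, one_div, inv_pow, ← div_eq_mul_inv, div_le_iff₀ (by positivity),
      inv_mul_eq_div, le_div_iff₀ (by positivity)]
    exact h5

theorem four_mul_card_add_le_netWidth {d n : ℕ} (hd : 1 ≤ d) :
    4 * #(multiIdx d n) + d ≤ netWidth d (n + 1) := by
  have h1 : (#(multiIdx d n) : ℝ) ≤ #(multiIdx d (n + 1)) := by
    refine Nat.cast_le.2 (card_le_card fun k hk => ?_)
    rw [mem_multiIdx] at hk ⊢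
    omega
  have h2 := card_multiIdx_le hd (n := n + 1) (by omega)
  have h3 := Nat.le_ceil ((d : ℝ) + 1 +
    6 * (Real.exp 1 * (((n + 1 : ℕ) : ℝ) + d) / d) ^ d)
  rw [← netWidth] at h3
  have h4 : (0 : ℝ) ≤ #(multiIdx d n) := Nat.cast_nonneg _
  have : ((4 * #(multiIdx d n) + d : ℕ) : ℝ) ≤ netWidth d (n + 1) := by
    push_cast at h2 h3 ⊢
    linarith
  exact_mod_cast this

/-! ### Assembling the network -/

theorem exists_net_approx_multiIdx {d : ℕ} (hd : 1 ≤ d) {n W H : ℕ} (hH : 1 ≤ H)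
    (hW : 4 * #(multiIdx d n) + d ≤ W) (coef : (Fin d → ℕ) → ℝ) :
    ∃ Φ ∈ netClass d W n H, ∀ x ∈ Set.Icc (0 : Fin d → ℝ) 1,
      |∑ m ∈ multiIdx d n, coef m * ∏ i, (2 * x i - 1) ^ m i - Φ.eval x| ≤
        (∑ m ∈ multiIdx d n, |coef m|) * (n * (1 / 4) ^ H) := by
  classical
  let var : multiIdx d n → Fin d := fun m => if h : ∃ i, m.1 i ≠ 0 then h.choose else ⟨0, hd⟩
  have hvar : ∀ m : multiIdx d n, ∑ i, m.1 i ≠ 0 → m.1 (var m) ≠ 0 := by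
    intro m hm
    have h : ∃ i, m.1 i ≠ 0 := by
      by_contra! h
      exact hm (sum_eq_zero fun i _ => h i)
    simp only [var, dif_pos h]
    exact h.choose_spec
  let parent : multiIdx d n → multiIdx d n := fun m =>
    ⟨Function.update m.1 (var m) (m.1 (var m) - 1), mem_multiIdx.2
      ((sum_le_sum fun i _ => by
        rcases eq_or_ne i (var m) with rfl | hi
        · simp
        · simp [hi]).trans (mem_multiIdx.1 m.2))⟩
  have hpar : ∀ m : multiIdx d n, ∑ i, m.1 i ≠ 0 → m.1 = (parent m).1 + Pi.single (var m) 1 := by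
    intro m hm
    have := hvar m hm
    ext i
    rcases eq_or_ne i (var m) with hi | hi
    · rw [hi]; simp [parent]; omega
    · simp [parent, hi]
  obtain ⟨Φ, hΦ, happ⟩ := exists_net_approx_polynomial hd (S := multiIdx d n) (n := n) hH
    (by simpa using hW) (fun m => ∑ i, m.1 i) (fun m => mem_multiIdx.1 m.2) parent var
    (fun x m => ∏ i, (2 * x i - 1) ^ m.1 i)
    (fun x m hm => prod_eq_one fun i _ => by
      rw [(sum_eq_zero_iff.1 hm) i (mem_univ i), pow_zero])
    (fun m j hj => by
      have h := hpar m (by omega)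
      refine ⟨?_, fun x => ?_⟩
      · rw [h] at hj
        simp only [Pi.add_apply, sum_add_distrib, sum_pi_single', mem_univ, if_true] at hj
        omega
      · conv_lhs => rw [h]
        simp only [Pi.add_apply, pow_add, prod_mul_distrib]
        congr 1
        rw [prod_eq_single (var m) (fun i _ hi => by simp [hi]) (by simp)]
        simp)
    (fun m => coef m.1)
  refine ⟨Φ, hΦ, fun x hx => ?_⟩
  rw [← sum_coe_sort (multiIdx d n) fun m => coef m * ∏ i, (2 * x i - 1) ^ m i,
    ← sum_coe_sort (multiIdx d n) fun m => |coef m|]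
  exact happ x hx

/-- The approximation theorem on the product of Bernstein ellipses, with a constant proportional to
the bound of the continuation there. -/
theorem exists_approxByNets_const {d : ℕ} (hd : 1 ≤ d) {β q ρ : ℝ} (hβ : 2 < β)
    (hρ : ρ = β ^ √(d : ℝ)) (hβq : β ≤ q) (hq : β < q ∨ d = 1 ∧ q = β) :
    ∃ C : ℝ, 0 < C ∧ ∀ (f : (Fin d → ℝ) → ℝ) (F : (Fin d → ℂ) → ℂ) (M : ℝ),
      AnalyticOnNhd ℂ F (polyEllipse d q) →
      (∀ x ∈ Set.Icc (0 : Fin d → ℝ) 1, F (fun i => (x i : ℂ)) = (f x : ℂ)) →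
      (∀ z ∈ polyEllipse d q, ‖F z‖ ≤ M) → ApproxByNets d ρ f (C * M) := by
  obtain ⟨B, hB0, hB⟩ := exists_tail_le (d := d) (q := q) (by linarith : 1 < β) hq
  have hq1 : 1 < q := by linarith
  have hd0 : (0 : ℝ) < √(d : ℝ) := Real.sqrt_pos.2 (by exact_mod_cast hd)
  have hr0 : 0 ≤ 2 * q⁻¹ := by positivity
  have hr1 : 2 * q⁻¹ < 1 := by
    rw [← div_eq_mul_inv, div_lt_one (by linarith)]; linarith
  have hr2 : 0 < (1 - 2 * q⁻¹)⁻¹ := inv_pos.2 (by linarith)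
  have hρ1 : 1 < ρ := by rw [hρ]; exact Real.one_lt_rpow (by linarith) hd0
  have hrate : ∀ N : ℕ, ρ ^ (-(N : ℝ) / √(d : ℝ)) = β⁻¹ ^ N := by
    intro N
    rw [hρ, ← Real.rpow_mul (by linarith), mul_div_cancel₀ _ hd0.ne', Real.rpow_neg (by linarith),
      Real.rpow_natCast, inv_pow]
  refine ⟨2 ^ d * (B * β) + 2 ^ d * (1 - 2 * q⁻¹)⁻¹ ^ d, by positivity,
    fun f F M hF hfF hM N hN => ?_⟩
  obtain ⟨n, rfl⟩ := Nat.exists_eq_add_of_le' hN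
  obtain ⟨A, hA, happ⟩ := exists_chebyshev_approx hq1 (hB n) hF hM
  obtain ⟨hH1, hH2⟩ := one_le_netHeight_and_pow_le hd hρ1 hN
  set H := netHeight d ρ (n + 1) with hH
  set coef : (Fin d → ℕ) → ℝ := fun m => ∑ k ∈ multiIdx d n, (A k).re * prodCoeff k m with hcoef
  obtain ⟨Φ, hΦ, hnet⟩ := exists_net_approx_multiIdx hd hH1 (four_mul_card_add_le_netWidth hd) coef
  have hcoefsum : ∑ m ∈ multiIdx d n, |coef m| ≤ 2 ^ d * M * (1 - 2 * q⁻¹)⁻¹ ^ d := by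
    have hM0 : 0 ≤ 2 ^ d * M := by
      simpa using (norm_nonneg _).trans (hA 0)
    calc ∑ m ∈ multiIdx d n, |coef m| ≤
        ∑ m ∈ multiIdx d n, ∑ k ∈ multiIdx d n, |(A k).re| * |prodCoeff k m| := by
          refine sum_le_sum fun m _ => (abs_sum_le_sum_abs _ _).trans_eq ?_
          exact sum_congr rfl fun k _ => abs_mul _ _
      _ = ∑ k ∈ multiIdx d n, |(A k).re| * ∑ m ∈ multiIdx d n, |prodCoeff k m| := by
          rw [sum_comm]; simp only [mul_sum]
      _ ≤ ∑ k ∈ multiIdx d n, 2 ^ d * M * (2 * q⁻¹) ^ ∑ i, k i := by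
          refine sum_le_sum fun k _ => ?_
          have h1 := (Complex.abs_re_le_norm _).trans (hA k)
          refine (mul_le_mul h1 (sum_abs_prodCoeff_le n k) (sum_nonneg fun _ _ => abs_nonneg _)
            ((abs_nonneg _).trans h1)).trans_eq ?_
          rw [mul_pow]; ring
      _ ≤ _ := by
          rw [← mul_sum]
          refine mul_le_mul_of_nonneg_left ?_ hM0
          exact (sum_le_sum_of_subset_of_nonneg (filter_subset _ _) fun _ _ _ => by
            positivity).trans (sum_box_pow_le hr0 hr1 d (n + 1))
  refine ⟨Φ, hΦ, fun x hx => ?_⟩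
  have hpoly : ∑ m ∈ multiIdx d n, coef m * ∏ i, (2 * x i - 1) ^ m i =
      ∑ k ∈ multiIdx d n, (A k).re * ∏ i, (Polynomial.Chebyshev.T ℝ (k i)).eval (x i) := by
    simp only [hcoef, sum_mul]
    rw [sum_comm]
    refine sum_congr rfl fun k hk => ?_
    rw [prod_cheb_eq_sum hk, mul_sum]
    exact sum_congr rfl fun m _ => mul_assoc _ _ _
  have hfp : |f x - ∑ m ∈ multiIdx d n, coef m * ∏ i, (2 * x i - 1) ^ m i| ≤
      2 ^ d * M * (B * β⁻¹ ^ n) := by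
    have hx1 : ∀ i, |x i| ≤ 1 := fun i => by
      rw [abs_of_nonneg (hx.1 i)]; exact hx.2 i
    refine le_trans ?_ (happ x hx1)
    rw [hfF x hx, hpoly]
    refine le_trans (le_of_eq ?_) (Complex.abs_re_le_norm _)
    rw [Complex.sub_re, Complex.ofReal_re, Complex.re_sum]
    simp only [Complex.re_mul_ofReal]
  have hpn := hnet x hx
  have hn4 : (n : ℝ) * (1 / 4) ^ H ≤ β⁻¹ ^ (n + 1) := by
    rw [← hrate]
    refine le_trans (mul_le_mul_of_nonneg_right ?_ (by positivity)) hH2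
    exact_mod_cast n.le_succ
  rw [hrate]
  calc |f x - Φ.eval x| ≤ 2 ^ d * M * (B * β⁻¹ ^ n) +
        2 ^ d * M * (1 - 2 * q⁻¹)⁻¹ ^ d * β⁻¹ ^ (n + 1) :=
        (abs_sub_le _ _ _).trans (add_le_add hfp (hpn.trans (mul_le_mul hcoefsum hn4 (by positivity)
          ((sum_nonneg fun _ _ => abs_nonneg _).trans hcoefsum))))
    _ = _ := by
        have : β⁻¹ ^ n = β * β⁻¹ ^ (n + 1) := by
          rw [pow_succ]; field_simp
        rw [this]; ring

end

theorem theorem2 (d : ℕ) (hd : 1 ≤ d) (ρ : ℝ) (hρ : (2 : ℝ) ^ √(d : ℝ) < ρ)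
    (E : Set (Fin d → ℂ)) (hE : E = complexEllipse d ρ ∨ E = normEllipse d ρ) :
    (∀ f : (Fin d → ℝ) → ℝ,
      (∃ B : ℝ, ∀ x ∈ Set.Icc (0 : Fin d → ℝ) 1, |f x| ≤ B) →
      (∃ F : (Fin d → ℂ) → ℂ, IsAnalyticContinuation f F E) →
      ∃ C : ℝ, 0 < C ∧ ApproxByNets d ρ f C) ∧
    (∀ M : ℝ, ∃ C : ℝ, 0 < C ∧
      ∀ (f : (Fin d → ℝ) → ℝ) (F : (Fin d → ℂ) → ℂ),
        IsAnalyticContinuation f F E → (∀ z ∈ E, ‖F z‖ ≤ M) →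
        ApproxByNets d ρ f C) := by
  have hd0 : (0 : ℝ) < √(d : ℝ) := Real.sqrt_pos.2 (by exact_mod_cast hd)
  have hρ0 : 0 < ρ := (Real.rpow_pos_of_pos two_pos _).trans hρ
  set β : ℝ := ρ ^ (√(d : ℝ))⁻¹ with hβdef
  have hβρ : ρ = β ^ √(d : ℝ) := by
    rw [hβdef, ← Real.rpow_mul hρ0.le, inv_mul_cancel₀ hd0.ne', Real.rpow_one]
  have hβ : 2 < β := by
    rwa [hβρ, Real.rpow_lt_rpow_iff zero_le_two (by positivity) hd0] at hρ
  obtain ⟨q, hβq, hq, hqρ⟩ := exists_ellipse_parameter hd (by linarith) hβρ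
  obtain ⟨C, hC, happ⟩ := exists_approxByNets_const hd hβ hβρ hβq hq
  have hPE : polyEllipse d q ⊆ E := by
    rcases hE with rfl | rfl
    · exact polyEllipse_subset_complexEllipse hqρ
    · exact polyEllipse_subset_normEllipse hd hqρ
  refine ⟨?_, fun M => ⟨C * (|M| + 1), by positivity, fun f F hF hM => ?_⟩⟩
  · rintro f - ⟨F, hF⟩
    have hFP := hF.1.mono hPE
    obtain ⟨M, hM⟩ := (isCompact_polyEllipse d q).exists_bound_of_continuousOn hFP.continuousOn
    refine ⟨C * (|M| + 1), by positivity, happ f F _ hFP hF.2 fun z hz => ?_⟩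
    linarith [hM z hz, le_abs_self M]
  · refine happ f F _ (hF.1.mono hPE) hF.2 fun z hz => ?_
    linarith [hM z (hPE hz), le_abs_self M]
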